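/- Let $k$ be a field and let $D$ be a finite-dimensional division algebra over $k$ (a division ring that is a $k$-algebra of finite dimension). Let $D^*=\mathrm{Hom}_k(D,k)$ be the dual coalgebra, with $\Delta(f)=\sum f_1\otimes f_2$ determined by $f(ab)=\sum f_1(a)f_2(b)$ for all $a,b\in D$, and $\varepsilon(f)=f(1)$; regard $D^*$ as a $D^*$-bicomodule by the dual of the regular $D$-bimodule $D$. For a coalgebra $C$ and a $C$-bicomodule $M$ with coactions $\rho^l,\rho^r$, the cotensor coalgebra is $T_C(M)=\bigoplus_{n\ge 0}M^{\Box_C n}$, where $M^{\Box_C 0}=C$ and $M^{\Box_C n}=M\,\Box_C\cdots\Box_C\,M$ ($n$ factors). Its comultiplication is $\Delta_C$ on $C$, $\rho^l+\rho^r$ on $M$, and for $n\ge 2$ $$\Delta(m_1\Box\cdots\Box m_n)=\sum (m_1)_{-1}\otimes((m_1)_0\Box m_2\Box\cdots\Box m_n)+\sum_{i=1}^{n-1}(m_1\Box\cdots\Box m_i)\otimes(m_{i+1}\Box\cdots\Box m_n)+\sum (m_1\Box\cdots\Box m_{n-1}\Box (m_n)_0)\otimes (m_n)_1 ;$$ its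 counit is $\varepsilon_C$ on $C$ and $0$ on $M^{\Box_C n}$ for $n\ge1$. Put $\mathcal{DC}(D,\mathrm{id})=T_{D^*}(D^*)$. Let $D[[x]]$ be the ring of formal power series over $D$ in a central variable $x$. Let $D[[x]]^\circ$ be its finite dual: the coalgebra of all $k$-linear functionals $f:D[[x]]\to k$ that vanish on some two-sided ideal of finite $k$-codimension, with $\Delta(f)=\sum f_1\otimes f_2$ determined by $f(pq)=\sum f_1(p)f_2(q)$ and $\varepsilon(f)=f(1)$. Then $\mathcal{DC}(D,\mathrm{id})$ and $D[[x]]^\circ$ are isomorphic as $k$-coalgebras. -/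

import Mathlib

open scoped TensorProduct

noncomputable section

universe u v

/-! ### Naturality of the associator -/

section Assoc

variable {k : Type*} [Field k] {A B E A' B' E' F : Type*}
  [AddCommGroup A] [Module k A] [AddCommGroup B] [Module k B] [AddCommGroup E] [Module k E]
  [AddCommGroup A'] [Module k A'] [AddCommGroup B'] [Module k B'] [AddCommGroup E'] [Module k E']
  [AddCommGroup F] [Module k F]

theorem assoc_lTensor (g : E →ₗ[k] E') (y : (A ⊗[k] B) ⊗[k] E) :
    TensorProduct.assoc k A B E' (g.lTensor (A ⊗[k] B) y) =
      (g.lTensor B).lTensor A (TensorProduct.assoc k A B E y) :=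
  LinearMap.congr_fun (TensorProduct.ext_threefold (g := (TensorProduct.assoc k A B E').toLinearMap
    ∘ₗ g.lTensor (A ⊗[k] B)) (h := (g.lTensor B).lTensor A ∘ₗ
      (TensorProduct.assoc k A B E).toLinearMap) (fun _ _ _ => by simp)) y

theorem assoc_lTensor_rTensor (g : B →ₗ[k] B') (y : (A ⊗[k] B) ⊗[k] E) :
    TensorProduct.assoc k A B' E ((g.lTensor A).rTensor E y) =
      (g.rTensor E).lTensor A (TensorProduct.assoc k A B E y) :=
  LinearMap.congr_fun (TensorProduct.ext_threefold (g := (TensorProduct.assoc k A B' E).toLinearMap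
    ∘ₗ (g.lTensor A).rTensor E) (h := (g.rTensor E).lTensor A ∘ₗ
      (TensorProduct.assoc k A B E).toLinearMap) (fun _ _ _ => by simp)) y

theorem assoc_rTensor (g : A →ₗ[k] A') (y : (A ⊗[k] B) ⊗[k] E) :
    TensorProduct.assoc k A' B E ((g.rTensor B).rTensor E y) =
      g.rTensor (B ⊗[k] E) (TensorProduct.assoc k A B E y) :=
  LinearMap.congr_fun (TensorProduct.ext_threefold (g := (TensorProduct.assoc k A' B E).toLinearMap
    ∘ₗ (g.rTensor B).rTensor E) (h := g.rTensor (B ⊗[k] E) ∘ₗ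
      (TensorProduct.assoc k A B E).toLinearMap) (fun _ _ _ => by simp)) y

theorem lTensor_rTensor_comm (f : A →ₗ[k] A') (g : B →ₗ[k] B') (y : A ⊗[k] B) :
    g.lTensor A' (f.rTensor B y) = f.rTensor B' (g.lTensor A y) :=
  LinearMap.congr_fun (TensorProduct.ext' (g := g.lTensor A' ∘ₗ f.rTensor B)
    (h := f.rTensor B' ∘ₗ g.lTensor A) (fun _ _ => by simp)) y

theorem assoc_pentagon (y : ((A ⊗[k] B) ⊗[k] E) ⊗[k] F) :
    TensorProduct.assoc k A B (E ⊗[k] F) (TensorProduct.assoc k (A ⊗[k] B) E F y) =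
      (TensorProduct.assoc k B E F).toLinearMap.lTensor A
        (TensorProduct.assoc k A (B ⊗[k] E) F
          ((TensorProduct.assoc k A B E).toLinearMap.rTensor F y)) :=
  LinearMap.congr_fun (TensorProduct.ext_fourfold
    (g := (TensorProduct.assoc k A B (E ⊗[k] F)).toLinearMap ∘ₗ
      (TensorProduct.assoc k (A ⊗[k] B) E F).toLinearMap)
    (h := (TensorProduct.assoc k B E F).toLinearMap.lTensor A ∘ₗ
      (TensorProduct.assoc k A (B ⊗[k] E) F).toLinearMap ∘ₗ
        (TensorProduct.assoc k A B E).toLinearMap.rTensor F) (fun _ _ _ _ => by simp)) y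

end Assoc

/-! ### Restricting maps to equalizers tensored with a vector space -/

section Equalizer

variable {k : Type*} [Field k] {V W U X : Type*}
  [AddCommGroup V] [Module k V] [AddCommGroup W] [Module k W]
  [AddCommGroup U] [Module k U] [AddCommGroup X] [Module k X]

theorem eqLocus_subtype_rTensor_injective (f g : V →ₗ[k] W) :
    Function.Injective ((LinearMap.eqLocus f g).subtype.rTensor U) :=
  Module.Flat.rTensor_preserves_injective_linearMap _ (Submodule.injective_subtype _)

theorem eqLocus_subtype_lTensor_injective (f g : V →ₗ[k] W) :
    Function.Injective ((LinearMap.eqLocus f g).subtype.lTensor U) :=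
  Module.Flat.lTensor_preserves_injective_linearMap _ (Submodule.injective_subtype _)

theorem mem_range_eqLocus_rTensor (f g : V →ₗ[k] W) (x : V ⊗[k] U)
    (h : f.rTensor U x = g.rTensor U x) :
    x ∈ LinearMap.range ((LinearMap.eqLocus f g).subtype.rTensor U) := by
  rw [LinearMap.eqLocus_eq_ker_sub]
  have := Module.Flat.rTensor_exact U (LinearMap.exact_subtype_ker_map (f - g))
  refine (this x).1 ?_
  rw [LinearMap.rTensor_sub, LinearMap.sub_apply, h, sub_self]

theorem mem_range_eqLocus_lTensor (f g : V →ₗ[k] W) (x : U ⊗[k] V)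
    (h : f.lTensor U x = g.lTensor U x) :
    x ∈ LinearMap.range ((LinearMap.eqLocus f g).subtype.lTensor U) := by
  rw [LinearMap.eqLocus_eq_ker_sub]
  have := Module.Flat.lTensor_exact U (LinearMap.exact_subtype_ker_map (f - g))
  refine (this x).1 ?_
  rw [LinearMap.lTensor_sub, LinearMap.sub_apply, h, sub_self]

/-- A linear map `h : X → V ⊗ U` with `(f ⊗ U) h = (g ⊗ U) h`, as a map to `Eq(f, g) ⊗ U`. -/
def liftEqLocusR (f g : V →ₗ[k] W) (h : X →ₗ[k] V ⊗[k] U)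
    (hh : ∀ x, f.rTensor U (h x) = g.rTensor U (h x)) :
    X →ₗ[k] LinearMap.eqLocus f g ⊗[k] U :=
  LinearMap.codRestrictOfInjective h ((LinearMap.eqLocus f g).subtype.rTensor U)
    (eqLocus_subtype_rTensor_injective f g) (fun x => mem_range_eqLocus_rTensor f g _ (hh x))

theorem liftEqLocusR_spec (f g : V →ₗ[k] W) (h : X →ₗ[k] V ⊗[k] U)
    (hh : ∀ x, f.rTensor U (h x) = g.rTensor U (h x)) (x : X) :
    (LinearMap.eqLocus f g).subtype.rTensor U (liftEqLocusR f g h hh x) = h x :=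
  LinearMap.codRestrictOfInjective_comp_apply _ _ _ _ x

/-- A linear map `h : X → U ⊗ V` with `(U ⊗ f) h = (U ⊗ g) h`, as a map to `U ⊗ Eq(f, g)`. -/
def liftEqLocusL (f g : V →ₗ[k] W) (h : X →ₗ[k] U ⊗[k] V)
    (hh : ∀ x, f.lTensor U (h x) = g.lTensor U (h x)) :
    X →ₗ[k] U ⊗[k] LinearMap.eqLocus f g :=
  LinearMap.codRestrictOfInjective h ((LinearMap.eqLocus f g).subtype.lTensor U)
    (eqLocus_subtype_lTensor_injective f g) (fun x => mem_range_eqLocus_lTensor f g _ (hh x))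

theorem liftEqLocusL_spec (f g : V →ₗ[k] W) (h : X →ₗ[k] U ⊗[k] V)
    (hh : ∀ x, f.lTensor U (h x) = g.lTensor U (h x)) (x : X) :
    (LinearMap.eqLocus f g).subtype.lTensor U (liftEqLocusL f g h hh x) = h x :=
  LinearMap.codRestrictOfInjective_comp_apply _ _ _ _ x

end Equalizer

/-! ### Bicomodules and the cotensor product -/

/-- A (counital) bicomodule over the `k`-coalgebra `C`. -/
structure Bicomodule (k : Type u) [Field k] (C : Type v) [AddCommGroup C] [Module k C]
    [Coalgebra k C] where
  /-- The underlying vector space. -/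
  carrier : Type v
  [addCommGroup : AddCommGroup carrier]
  [module : Module k carrier]
  /-- The left coaction. -/
  lco : carrier →ₗ[k] C ⊗[k] carrier
  /-- The right coaction. -/
  rco : carrier →ₗ[k] carrier ⊗[k] C
  lco_coassoc : ∀ m, TensorProduct.assoc k C C carrier
    ((Coalgebra.comul (R := k) (A := C)).rTensor carrier (lco m)) = lco.lTensor C (lco m)
  lco_counit : ∀ m, (Coalgebra.counit (R := k) (A := C)).rTensor carrier (lco m) = 1 ⊗ₜ[k] m
  rco_coassoc : ∀ m, TensorProduct.assoc k carrier C C (rco.rTensor C (rco m)) =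
    (Coalgebra.comul (R := k) (A := C)).lTensor carrier (rco m)
  rco_counit : ∀ m, (Coalgebra.counit (R := k) (A := C)).lTensor carrier (rco m) = m ⊗ₜ[k] 1
  /-- The two coactions commute. -/
  lco_rco : ∀ m, TensorProduct.assoc k C carrier C (lco.rTensor C (rco m)) =
    rco.lTensor C (lco m)

namespace Bicomodule

attribute [instance] Bicomodule.addCommGroup Bicomodule.module

variable {k : Type u} [Field k] {C : Type v} [AddCommGroup C] [Module k C] [Coalgebra k C]

variable (k C) in
/-- The coalgebra `C` as a bicomodule over itself. -/
def regular : Bicomodule k C where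
  carrier := C
  lco := Coalgebra.comul
  rco := Coalgebra.comul
  lco_coassoc m := Coalgebra.coassoc_apply m
  lco_counit m := Coalgebra.rTensor_counit_comul m
  rco_coassoc m := Coalgebra.coassoc_apply m
  rco_counit m := Coalgebra.lTensor_counit_comul m
  lco_rco m := Coalgebra.coassoc_apply m

/-- The map `ρʳ ⊗ N : M ⊗ N → M ⊗ C ⊗ N`. -/
def cotensorLeft (M N : Bicomodule k C) :
    M.carrier ⊗[k] N.carrier →ₗ[k] M.carrier ⊗[k] (C ⊗[k] N.carrier) :=
  (TensorProduct.assoc k M.carrier C N.carrier).toLinearMap ∘ₗ M.rco.rTensor N.carrier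

/-- The map `M ⊗ ρˡ : M ⊗ N → M ⊗ C ⊗ N`. -/
def cotensorRight (M N : Bicomodule k C) :
    M.carrier ⊗[k] N.carrier →ₗ[k] M.carrier ⊗[k] (C ⊗[k] N.carrier) :=
  N.lco.lTensor M.carrier

/-- The underlying vector space of the cotensor product `M □_C N`, the equalizer of
`ρʳ ⊗ N` and `M ⊗ ρˡ`. -/
def cotensorSpace (M N : Bicomodule k C) : Submodule k (M.carrier ⊗[k] N.carrier) :=
  LinearMap.eqLocus (cotensorLeft M N) (cotensorRight M N)

section Restrict

variable (M : Bicomodule k C) {N N' : Bicomodule k C} {U : Type*} [AddCommGroup U] [Module k U]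

/-- `d : N → N' ⊗ U` is a map of left `C`-comodules, where `C` coacts on `N' ⊗ U` through `N'`. -/
def IsLeftColinear (d : N.carrier →ₗ[k] N'.carrier ⊗[k] U) : Prop :=
  ∀ n, TensorProduct.assoc k C N'.carrier U (N'.lco.rTensor U (d n)) = d.lTensor C (N.lco n)

/-- `M ⊗ d`, as a map `M ⊗ N → (M ⊗ N') ⊗ U`. -/
def tensorMap (d : N.carrier →ₗ[k] N'.carrier ⊗[k] U) :
    M.carrier ⊗[k] N.carrier →ₗ[k] (M.carrier ⊗[k] N'.carrier) ⊗[k] U :=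
  (TensorProduct.assoc k M.carrier N'.carrier U).symm.toLinearMap ∘ₗ d.lTensor M.carrier

theorem assoc_tensorMap (d : N.carrier →ₗ[k] N'.carrier ⊗[k] U)
    (x : M.carrier ⊗[k] N.carrier) :
    TensorProduct.assoc k M.carrier N'.carrier U (tensorMap M d x) = d.lTensor M.carrier x := by
  simp [tensorMap]

/-- The canonical identification of `(M ⊗ (C ⊗ N')) ⊗ U` with `M ⊗ (C ⊗ (N' ⊗ U))`. -/
def reassoc (M N' : Bicomodule k C) (U : Type*) [AddCommGroup U] [Module k U] :
    (M.carrier ⊗[k] (C ⊗[k] N'.carrier)) ⊗[k] U ≃ₗ[k]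
      M.carrier ⊗[k] (C ⊗[k] (N'.carrier ⊗[k] U)) :=
  TensorProduct.assoc k M.carrier (C ⊗[k] N'.carrier) U ≪≫ₗ
    (TensorProduct.assoc k C N'.carrier U).lTensor M.carrier

theorem cotensorLeft_tensorMap (d : N.carrier →ₗ[k] N'.carrier ⊗[k] U)
    (x : M.carrier ⊗[k] N.carrier) :
    reassoc M N' U ((cotensorLeft M N').rTensor U (tensorMap M d x)) =
      (d.lTensor C).lTensor M.carrier (cotensorLeft M N x) := by
  simp only [reassoc, cotensorLeft, LinearMap.comp_apply, LinearMap.rTensor_comp,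
    LinearEquiv.trans_apply, LinearEquiv.coe_coe, ← assoc_lTensor, lTensor_rTensor_comm,
    ← assoc_tensorMap, ← assoc_rTensor]
  exact (assoc_pentagon _).symm

theorem cotensorRight_tensorMap (d : N.carrier →ₗ[k] N'.carrier ⊗[k] U) (hd : IsLeftColinear d)
    (x : M.carrier ⊗[k] N.carrier) :
    reassoc M N' U ((cotensorRight M N').rTensor U (tensorMap M d x)) =
      (d.lTensor C).lTensor M.carrier (cotensorRight M N x) := by
  have hd' : (TensorProduct.assoc k C N'.carrier U).toLinearMap ∘ₗ N'.lco.rTensor U ∘ₗ d =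
    d.lTensor C ∘ₗ N.lco := LinearMap.ext hd
  simp only [reassoc, cotensorRight, LinearEquiv.trans_apply, assoc_lTensor_rTensor,
    assoc_tensorMap]
  rw [← LinearMap.lTensor_comp_apply, ← LinearMap.lTensor_comp_apply, ← hd',
    LinearMap.lTensor_comp_apply, LinearMap.lTensor_comp_apply, LinearMap.lTensor_comp_apply]
  rfl

/-- The restriction `M □ N → (M □ N') ⊗ U` of `M ⊗ d`, for a map `d : N → N' ⊗ U` of left
`C`-comodules. -/
def cotensorMap (d : N.carrier →ₗ[k] N'.carrier ⊗[k] U) (hd : IsLeftColinear d) :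
    cotensorSpace M N →ₗ[k] cotensorSpace M N' ⊗[k] U :=
  liftEqLocusR (cotensorLeft M N') (cotensorRight M N')
    (tensorMap M d ∘ₗ (cotensorSpace M N).subtype) (fun x => by
      apply (reassoc M N' U).injective
      have hx : cotensorLeft M N x = cotensorRight M N x := x.2
      simp only [LinearMap.comp_apply, Submodule.subtype_apply, cotensorLeft_tensorMap,
        cotensorRight_tensorMap M d hd, hx])

theorem cotensorMap_spec (d : N.carrier →ₗ[k] N'.carrier ⊗[k] U) (hd : IsLeftColinear d)
    (x : cotensorSpace M N) :
    (cotensorSpace M N').subtype.rTensor U (cotensorMap M d hd x) = tensorMap M d x :=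
  liftEqLocusR_spec _ _ _ _ x

end Restrict

/-- `ρˡ ⊗ N`, as a map `M ⊗ N → C ⊗ (M ⊗ N)`. -/
def tensorLco (M N : Bicomodule k C) :
    M.carrier ⊗[k] N.carrier →ₗ[k] C ⊗[k] (M.carrier ⊗[k] N.carrier) :=
  (TensorProduct.assoc k C M.carrier N.carrier).toLinearMap ∘ₗ M.lco.rTensor N.carrier

/-- The left coaction of the cotensor product `M □ N`, restricting `ρˡ ⊗ N`. -/
def cotensorLco (M N : Bicomodule k C) :
    cotensorSpace M N →ₗ[k] C ⊗[k] cotensorSpace M N :=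
  liftEqLocusL (cotensorLeft M N) (cotensorRight M N)
    (tensorLco M N ∘ₗ (cotensorSpace M N).subtype) (fun x => by
      have hx : cotensorLeft M N x = cotensorRight M N x := x.2
      have h1 : ∀ y, (cotensorLeft M N).lTensor C (tensorLco M N y) =
          TensorProduct.assoc k C M.carrier (C ⊗[k] N.carrier)
            (M.lco.rTensor (C ⊗[k] N.carrier) (cotensorLeft M N y)) := by
        intro y
        have hl : (TensorProduct.assoc k C M.carrier C).toLinearMap ∘ₗ M.lco.rTensor C ∘ₗ M.rco =
          M.rco.lTensor C ∘ₗ M.lco := LinearMap.ext M.lco_rco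
        simp only [cotensorLeft, tensorLco, LinearMap.comp_apply, LinearMap.lTensor_comp,
          LinearEquiv.coe_coe, ← assoc_lTensor_rTensor, ← assoc_rTensor]
        rw [assoc_pentagon, ← LinearMap.rTensor_comp_apply, ← hl, LinearMap.rTensor_comp_apply,
          LinearMap.rTensor_comp_apply]
      have h2 : ∀ y, (cotensorRight M N).lTensor C (tensorLco M N y) =
          TensorProduct.assoc k C M.carrier (C ⊗[k] N.carrier)
            (M.lco.rTensor (C ⊗[k] N.carrier) (cotensorRight M N y)) := by
        intro y
        simp only [cotensorRight, tensorLco, LinearMap.comp_apply, LinearEquiv.coe_coe,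
          ← assoc_lTensor, lTensor_rTensor_comm]
      simp only [LinearMap.comp_apply, Submodule.subtype_apply, h1, h2, hx])

theorem cotensorLco_spec (M N : Bicomodule k C) (x : cotensorSpace M N) :
    (cotensorSpace M N).subtype.lTensor C (cotensorLco M N x) = tensorLco M N x :=
  liftEqLocusL_spec _ _ _ _ x

theorem rco_colinear (N : Bicomodule k C) : IsLeftColinear N.rco := N.lco_rco

theorem assoc_cotensorMap (M : Bicomodule k C) {N P Q : Bicomodule k C} {U W S : Type*}
    [AddCommGroup U] [Module k U] [AddCommGroup W] [Module k W] [AddCommGroup S] [Module k S]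
    (d₁ : N.carrier →ₗ[k] P.carrier ⊗[k] U) (h₁ : IsLeftColinear d₁)
    (d₂ : P.carrier →ₗ[k] Q.carrier ⊗[k] W) (h₂ : IsLeftColinear d₂)
    (d₃ : N.carrier →ₗ[k] Q.carrier ⊗[k] S) (h₃ : IsLeftColinear d₃)
    (e : S →ₗ[k] W ⊗[k] U)
    (H : ∀ n, TensorProduct.assoc k Q.carrier W U (d₂.rTensor U (d₁ n)) =
      e.lTensor Q.carrier (d₃ n)) (x : cotensorSpace M N) :
    TensorProduct.assoc k (cotensorSpace M Q) W U
      ((cotensorMap M d₂ h₂).rTensor U (cotensorMap M d₁ h₁ x)) =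
      e.lTensor (cotensorSpace M Q) (cotensorMap M d₃ h₃ x) := by
  apply eqLocus_subtype_rTensor_injective (cotensorLeft M Q) (cotensorRight M Q)
  change (cotensorSpace M Q).subtype.rTensor _ _ = (cotensorSpace M Q).subtype.rTensor _ _
  have h : (cotensorSpace M Q).subtype.rTensor W ∘ₗ cotensorMap M d₂ h₂ =
    tensorMap M d₂ ∘ₗ (cotensorSpace M P).subtype := LinearMap.ext (cotensorMap_spec M d₂ h₂)
  rw [← assoc_rTensor, ← LinearMap.rTensor_comp_apply, h, LinearMap.rTensor_comp_apply,
    cotensorMap_spec, ← lTensor_rTensor_comm, cotensorMap_spec]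
  apply (TensorProduct.assoc k M.carrier Q.carrier (W ⊗[k] U)).injective
  rw [assoc_lTensor, assoc_tensorMap, assoc_pentagon, ← LinearMap.rTensor_comp_apply]
  have h' : (TensorProduct.assoc k M.carrier Q.carrier W).toLinearMap ∘ₗ tensorMap M d₂ =
    d₂.lTensor M.carrier := LinearMap.ext (assoc_tensorMap M d₂)
  have H' : (TensorProduct.assoc k Q.carrier W U).toLinearMap ∘ₗ d₂.rTensor U ∘ₗ d₁ =
    e.lTensor Q.carrier ∘ₗ d₃ := LinearMap.ext H
  rw [h', assoc_lTensor_rTensor, assoc_tensorMap, ← LinearMap.lTensor_comp_apply,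
    ← LinearMap.lTensor_comp_apply, LinearMap.comp_assoc,
    ← LinearMap.lTensor_comp_apply, H']

theorem cotensorMap_colinear (M : Bicomodule k C) {N N' : Bicomodule k C} {U : Type*}
    [AddCommGroup U] [Module k U] (d : N.carrier →ₗ[k] N'.carrier ⊗[k] U)
    (hd : IsLeftColinear d) (x : cotensorSpace M N) :
    TensorProduct.assoc k C (cotensorSpace M N') U
      ((cotensorLco M N').rTensor U (cotensorMap M d hd x)) =
      (cotensorMap M d hd).lTensor C (cotensorLco M N x) := by
  apply Module.Flat.lTensor_preserves_injective_linearMap (M := C) _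
    (eqLocus_subtype_rTensor_injective (U := U) (cotensorLeft M N') (cotensorRight M N'))
  change ((cotensorSpace M N').subtype.rTensor U).lTensor C _ =
    ((cotensorSpace M N').subtype.rTensor U).lTensor C _
  have h₁ : (cotensorSpace M N').subtype.rTensor U ∘ₗ cotensorMap M d hd =
    tensorMap M d ∘ₗ (cotensorSpace M N).subtype := LinearMap.ext (cotensorMap_spec M d hd)
  have h₂ : (cotensorSpace M N').subtype.lTensor C ∘ₗ cotensorLco M N' =
    tensorLco M N' ∘ₗ (cotensorSpace M N').subtype := LinearMap.ext (cotensorLco_spec M N')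
  rw [← LinearMap.lTensor_comp_apply, h₁, LinearMap.lTensor_comp_apply, cotensorLco_spec,
    ← assoc_lTensor_rTensor, ← LinearMap.rTensor_comp_apply, h₂, LinearMap.rTensor_comp_apply,
    cotensorMap_spec]
  apply ((TensorProduct.assoc k M.carrier N'.carrier U).lTensor C).injective
  change (TensorProduct.assoc k M.carrier N'.carrier U).toLinearMap.lTensor C _ =
    (TensorProduct.assoc k M.carrier N'.carrier U).toLinearMap.lTensor C _
  have h' : (TensorProduct.assoc k M.carrier N'.carrier U).toLinearMap ∘ₗ tensorMap M d =
    d.lTensor M.carrier := LinearMap.ext (assoc_tensorMap M d)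
  rw [← LinearMap.lTensor_comp_apply C _ (tensorMap M d), h', tensorLco, tensorLco,
    LinearMap.rTensor_comp, LinearMap.comp_apply, LinearMap.comp_apply, ← assoc_pentagon,
    assoc_rTensor, assoc_tensorMap, LinearEquiv.coe_coe, ← assoc_lTensor, lTensor_rTensor_comm]

/-- The cotensor product `M □_C N` of two bicomodules, with the coactions `ρˡ ⊗ N` and `M ⊗ ρʳ`. -/
def cotensor (M N : Bicomodule k C) : Bicomodule k C where
  carrier := cotensorSpace M N
  lco := cotensorLco M N
  rco := cotensorMap M N.rco N.rco_colinear
  lco_coassoc x := by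
    apply Module.Flat.lTensor_preserves_injective_linearMap (M := C) _
      (eqLocus_subtype_lTensor_injective (U := C) (cotensorLeft M N) (cotensorRight M N))
    have h : (cotensorSpace M N).subtype.lTensor C ∘ₗ cotensorLco M N =
      tensorLco M N ∘ₗ (cotensorSpace M N).subtype := LinearMap.ext (cotensorLco_spec M N)
    change ((cotensorSpace M N).subtype.lTensor C).lTensor C _ =
      ((cotensorSpace M N).subtype.lTensor C).lTensor C _
    rw [← LinearMap.lTensor_comp_apply, h, LinearMap.lTensor_comp_apply, cotensorLco_spec,
      ← assoc_lTensor, lTensor_rTensor_comm, cotensorLco_spec]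
    have hl : (TensorProduct.assoc k C C M.carrier).toLinearMap ∘ₗ
        (Coalgebra.comul (R := k) (A := C)).rTensor M.carrier ∘ₗ M.lco =
      M.lco.lTensor C ∘ₗ M.lco := LinearMap.ext M.lco_coassoc
    simp only [tensorLco, LinearMap.comp_apply, LinearMap.lTensor_comp,
      LinearEquiv.coe_coe, ← assoc_lTensor_rTensor, ← assoc_rTensor]
    rw [assoc_pentagon, ← LinearMap.rTensor_comp_apply N.carrier (M.lco.lTensor C), ← hl,
      LinearMap.rTensor_comp_apply, LinearMap.rTensor_comp_apply]
  lco_counit x := by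
    apply Module.Flat.lTensor_preserves_injective_linearMap (M := k) _
      (Submodule.injective_subtype (cotensorSpace M N))
    rw [lTensor_rTensor_comm, cotensorLco_spec]
    have hl : (Coalgebra.counit (R := k) (A := C)).rTensor M.carrier ∘ₗ M.lco =
      TensorProduct.mk k k M.carrier 1 := LinearMap.ext M.lco_counit
    simp only [tensorLco, LinearMap.comp_apply, LinearEquiv.coe_coe, ← assoc_rTensor,
      LinearMap.lTensor_tmul, Submodule.subtype_apply]
    rw [← LinearMap.rTensor_comp_apply, hl]
    generalize (x : M.carrier ⊗[k] N.carrier) = y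
    induction y with
    | zero => simp
    | add a b ha hb => simp [ha, hb, TensorProduct.tmul_add]
    | tmul a b => simp
  rco_coassoc x := assoc_cotensorMap M N.rco N.rco_colinear N.rco N.rco_colinear N.rco N.rco_colinear _
    N.rco_coassoc x
  rco_counit x := by
    apply Module.Flat.rTensor_preserves_injective_linearMap (M := k) _
      (Submodule.injective_subtype (cotensorSpace M N))
    rw [← lTensor_rTensor_comm, cotensorMap_spec M N.rco N.rco_colinear]
    apply (TensorProduct.assoc k M.carrier N.carrier k).injective
    have hl : (Coalgebra.counit (R := k) (A := C)).lTensor N.carrier ∘ₗ N.rco =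
      (TensorProduct.mk k N.carrier k).flip 1 := LinearMap.ext N.rco_counit
    rw [assoc_lTensor, assoc_tensorMap, ← LinearMap.lTensor_comp_apply, hl,
      LinearMap.rTensor_tmul, Submodule.subtype_apply]
    generalize (x : M.carrier ⊗[k] N.carrier) = y
    induction y with
    | zero => simp
    | add a b ha hb => simp [ha, hb, TensorProduct.add_tmul]
    | tmul a b => simp
  lco_rco x := cotensorMap_colinear M N.rco N.rco_colinear x

/-- The cotensor powers `M^{□ n}` of a `C`-bicomodule, with `M^{□ 0} = C`. -/
def pow (M : Bicomodule k C) : ℕ → Bicomodule k C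
  | 0 => regular k C
  | 1 => M
  | n + 2 => cotensor M (pow M (n + 1))

/-- The component `M^{□ (j + i)} → M^{□ i} ⊗ M^{□ j}` of the comultiplication of the cotensor
coalgebra, together with the fact that it is a map of left `C`-comodules. It is the left coaction
for `i = 0`, the right coaction of `M` for `(i, j) = (1, 0)`, and in the other cases it splits
`m₁ □ ⋯ □ mᵢ₊ⱼ` as `(m₁ □ ⋯ □ mᵢ) ⊗ (mᵢ₊₁ □ ⋯ □ mᵢ₊ⱼ)`, or coacts on the last factor if `j = 0`. -/
def split (M : Bicomodule k C) : (i j : ℕ) →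
    {d : (pow M (j + i)).carrier →ₗ[k] (pow M i).carrier ⊗[k] (pow M j).carrier //
      IsLeftColinear d}
  | 0, j => ⟨(pow M j).lco, (pow M j).lco_coassoc⟩
  | 1, 0 => ⟨M.rco, M.rco_colinear⟩
  | 1, j + 1 => ⟨(cotensorSpace M (pow M (j + 1))).subtype,
      fun x => (cotensorLco_spec M (pow M (j + 1)) x).symm⟩
  | i + 2, j => ⟨cotensorMap M (split M (i + 1) j).1 (split M (i + 1) j).2,
      cotensorMap_colinear M (split M (i + 1) j).1 (split M (i + 1) j).2⟩

/-- `split` with a free source index `n`, extended by `0` to `n ≠ j + i`. -/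
def splitAt (M : Bicomodule k C) (i j n : ℕ) :
    (pow M n).carrier →ₗ[k] (pow M i).carrier ⊗[k] (pow M j).carrier :=
  if h : j + i = n then h ▸ (split M i j).1 else 0

theorem splitAt_eq (M : Bicomodule k C) (i j : ℕ) : splitAt M i j (j + i) = (split M i j).1 := by
  simp [splitAt]

theorem splitAt_colinear (M : Bicomodule k C) (i j n : ℕ) : IsLeftColinear (splitAt M i j n) := by
  by_cases h : j + i = n
  · subst h
    rw [splitAt_eq]
    exact (split M i j).2
  · intro x
    simp [splitAt, h]

theorem splitAt_zero (M : Bicomodule k C) (j : ℕ) : splitAt M 0 j j = (pow M j).lco :=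
  splitAt_eq M 0 j

theorem splitAt_one_zero (M : Bicomodule k C) : splitAt M 1 0 1 = M.rco :=
  splitAt_eq M 1 0

theorem splitAt_one_succ (M : Bicomodule k C) (j : ℕ) :
    splitAt M 1 (j + 1) (j + 2) = (cotensorSpace M (pow M (j + 1))).subtype :=
  splitAt_eq M 1 (j + 1)

theorem splitAt_succ_succ (M : Bicomodule k C) (i j n : ℕ) (h : j + i = n) :
    splitAt M (i + 2) j (n + 2) =
      cotensorMap M (splitAt M (i + 1) j (n + 1)) (splitAt_colinear M (i + 1) j (n + 1)) := by
  subst h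
  have h₁ : splitAt M (i + 1) j (j + i + 1) = (split M (i + 1) j).1 := splitAt_eq M (i + 1) j
  refine (splitAt_eq M (i + 2) j).trans ?_
  change cotensorMap M (split M (i + 1) j).1 (split M (i + 1) j).2 = _
  congr 1
  exact h₁.symm

theorem splitAt_coassoc (M : Bicomodule k C) : ∀ (a b c p q n : ℕ) (_ : b + a = p) (_ : c + b = q)
    (_ : q + a = n) (x : (pow M n).carrier),
    TensorProduct.assoc k (pow M a).carrier (pow M b).carrier (pow M c).carrier
      ((splitAt M a b p).rTensor (pow M c).carrier (splitAt M p c n x)) =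
      (splitAt M b c q).lTensor (pow M a).carrier (splitAt M a q n x)
  | 0, b, c, p, q, n, hp, hq, hn, x => by
    obtain rfl : b = p := hp
    obtain rfl : q = n := hn
    rw [splitAt_zero, splitAt_zero]
    exact splitAt_colinear M b c q x
  | 1, 0, 0, p, q, n, hp, hq, hn, x => by
    obtain rfl : 1 = p := hp
    obtain rfl : 0 = q := hq
    obtain rfl : 1 = n := hn
    rw [splitAt_one_zero, splitAt_zero]
    exact M.rco_coassoc x
  | 1, 0, c + 1, p, q, n, hp, hq, hn, x => by
    obtain rfl : 1 = p := hp
    obtain rfl : c + 1 = q := hq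
    obtain rfl : c + 2 = n := hn
    rw [splitAt_one_zero, splitAt_one_succ, splitAt_zero]
    exact x.2
  | 1, b + 1, c, p, q, n, hp, hq, hn, x => by
    obtain rfl : b + 2 = p := hp
    obtain rfl : c + b + 1 = q := hq
    obtain rfl : c + b + 2 = n := hn
    rw [splitAt_one_succ, splitAt_one_succ, splitAt_succ_succ M b c (c + b) rfl]
    exact (congrArg _ (cotensorMap_spec M _ _ x)).trans (assoc_tensorMap M _ _)
  | a + 2, b, c, p, q, n, hp, hq, hn, x => by
    obtain rfl : b + a + 2 = p := hp
    obtain rfl : q + a + 2 = n := hn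
    rw [splitAt_succ_succ M a b (b + a) rfl, splitAt_succ_succ M a q (q + a) rfl,
      splitAt_succ_succ M (b + a) c (q + a) (by omega)]
    exact assoc_cotensorMap M _ _ _ _ _ _ _
      (splitAt_coassoc M (a + 1) b c (b + a + 1) q (q + a + 1) rfl hq rfl) x

/-- The comultiplication has counit `ε_C` on the left. -/
theorem splitAt_counit_left (M : Bicomodule k C) (n : ℕ) (x : (pow M n).carrier) :
    (Coalgebra.counit (R := k) (A := C)).rTensor (pow M n).carrier (splitAt M 0 n n x) =
      1 ⊗ₜ[k] x := by
  rw [splitAt_zero]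
  exact (pow M n).lco_counit x

/-- The components landing in `M^{□ n} ⊗ C` are the right coactions. -/
theorem splitAt_right (M : Bicomodule k C) : ∀ n : ℕ, splitAt M n 0 n = (pow M n).rco
  | 0 => splitAt_zero M 0
  | 1 => splitAt_one_zero M
  | n + 2 => by
    rw [splitAt_succ_succ M n 0 n (Nat.zero_add n)]
    change _ = cotensorMap M (pow M (n + 1)).rco (pow M (n + 1)).rco_colinear
    congr 1
    exact splitAt_right M (n + 1)

theorem splitAt_counit_right (M : Bicomodule k C) (n : ℕ) (x : (pow M n).carrier) :
    (Coalgebra.counit (R := k) (A := C)).lTensor (pow M n).carrier (splitAt M n 0 n x) =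
      x ⊗ₜ[k] 1 := by
  rw [splitAt_right]
  exact (pow M n).rco_counit x

end Bicomodule

/-! ### The cotensor coalgebra -/

/-- The cotensor coalgebra `T_C(M) = ⨁ₙ M^{□ n}` of a `C`-bicomodule `M`. -/
def CotensorCoalgebra {k : Type u} [Field k] {C : Type v} [AddCommGroup C] [Module k C]
    [Coalgebra k C] (M : Bicomodule k C) : Type v :=
  DirectSum ℕ fun n => (M.pow n).carrier

namespace CotensorCoalgebra

variable {k : Type u} [Field k] {C : Type v} [AddCommGroup C] [Module k C] [Coalgebra k C]

instance (M : Bicomodule k C) : AddCommGroup (CotensorCoalgebra M) :=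
  inferInstanceAs (AddCommGroup (DirectSum ℕ fun n => (M.pow n).carrier))

instance (M : Bicomodule k C) : Module k (CotensorCoalgebra M) :=
  inferInstanceAs (Module k (DirectSum ℕ fun n => (M.pow n).carrier))

/-- The inclusion `M^{□ n} → T_C(M)`. -/
def incl (M : Bicomodule k C) (n : ℕ) : (M.pow n).carrier →ₗ[k] CotensorCoalgebra M :=
  DirectSum.lof k ℕ (fun n => (M.pow n).carrier) n

/-- The linear map out of `T_C(M)` with given components. -/
def fromSum (M : Bicomodule k C) {V : Type*} [AddCommGroup V] [Module k V]
    (f : ∀ n, (M.pow n).carrier →ₗ[k] V) : CotensorCoalgebra M →ₗ[k] V :=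
  DirectSum.toModule k ℕ V f

@[simp]
theorem fromSum_incl (M : Bicomodule k C) {V : Type*} [AddCommGroup V] [Module k V]
    (f : ∀ n, (M.pow n).carrier →ₗ[k] V) (n : ℕ) (x : (M.pow n).carrier) :
    fromSum M f (incl M n x) = f n x :=
  DirectSum.toModule_lof (R := k) (M := fun n => (M.pow n).carrier) (φ := f) n x

theorem hom_ext (M : Bicomodule k C) {V : Type*} [AddCommGroup V] [Module k V]
    {f g : CotensorCoalgebra M →ₗ[k] V} (h : ∀ n x, f (incl M n x) = g (incl M n x)) : f = g :=
  DirectSum.linearMap_ext k fun n => LinearMap.ext (h n)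

/-- The comultiplication `Δ` and the counit `ε` of `T_C(M)`: on `M^{□ n}`, `Δ` is the sum of its
components in `M^{□ i} ⊗ M^{□ j}` over all `i + j = n`, and `ε` is the counit of `C` on
`M^{□ 0} = C` and zero on `M^{□ n}` for `n > 0`. -/
instance (M : Bicomodule k C) : CoalgebraStruct k (CotensorCoalgebra M) where
  comul := fromSum M fun n => ∑ p ∈ Finset.HasAntidiagonal.antidiagonal n,
    TensorProduct.map (incl M p.1) (incl M p.2) ∘ₗ M.splitAt p.1 p.2 n
  counit := fromSum M fun n => match n with
    | 0 => (Coalgebra.counit (R := k) (A := C))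
    | _ + 1 => 0

theorem comul_incl (M : Bicomodule k C) (n : ℕ) (x : (M.pow n).carrier) :
    Coalgebra.comul (R := k) (incl M n x) = ∑ p ∈ Finset.HasAntidiagonal.antidiagonal n,
      TensorProduct.map (incl M p.1) (incl M p.2) (M.splitAt p.1 p.2 n x) := by
  refine (fromSum_incl M _ n x).trans ?_
  simp

theorem counit_incl_zero (M : Bicomodule k C) (x : C) :
    Coalgebra.counit (R := k) (incl M 0 x) = Coalgebra.counit (R := k) x :=
  fromSum_incl M _ 0 x

theorem counit_incl_succ (M : Bicomodule k C) (n : ℕ) (x : (M.pow (n + 1)).carrier) :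
    Coalgebra.counit (R := k) (incl M (n + 1) x) = 0 :=
  fromSum_incl M _ (n + 1) x

instance (M : Bicomodule k C) : Coalgebra k (CotensorCoalgebra M) where
  coassoc := by
    apply hom_ext
    intro n x
    simp only [LinearMap.comp_apply, comul_incl, map_sum, LinearEquiv.coe_coe]
    have hL : ∀ i j (y : (M.pow i).carrier ⊗[k] (M.pow j).carrier),
        (Coalgebra.comul (R := k)).rTensor (CotensorCoalgebra M)
          (TensorProduct.map (incl M i) (incl M j) y) =
        ∑ q ∈ Finset.HasAntidiagonal.antidiagonal i,
          TensorProduct.map (TensorProduct.map (incl M q.1) (incl M q.2)) (incl M j)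
            ((M.splitAt q.1 q.2 i).rTensor (M.pow j).carrier y) := by
      intro i j y
      induction y with
      | zero => simp
      | add a b ha hb => simp only [map_add, ha, hb, Finset.sum_add_distrib]
      | tmul a b => simp [comul_incl, TensorProduct.sum_tmul]
    have hR : ∀ i j (y : (M.pow i).carrier ⊗[k] (M.pow j).carrier),
        (Coalgebra.comul (R := k)).lTensor (CotensorCoalgebra M)
          (TensorProduct.map (incl M i) (incl M j) y) =
        ∑ q ∈ Finset.HasAntidiagonal.antidiagonal j,
          TensorProduct.map (incl M i) (TensorProduct.map (incl M q.1) (incl M q.2))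
            ((M.splitAt q.1 q.2 j).lTensor (M.pow i).carrier y) := by
      intro i j y
      induction y with
      | zero => simp
      | add a b ha hb => simp only [map_add, ha, hb, Finset.sum_add_distrib]
      | tmul a b => simp [comul_incl, TensorProduct.tmul_sum]
    simp only [hL, hR, map_sum, ← TensorProduct.map_map_assoc]
    rw [Finset.sum_sigma', Finset.sum_sigma']
    refine Finset.sum_nbij' (fun s => ⟨(s.2.1, s.2.2 + s.1.2), (s.2.2, s.1.2)⟩)
      (fun s => ⟨(s.1.1 + s.2.1, s.2.2), (s.1.1, s.2.1)⟩) ?_ ?_ ?_ ?_ ?_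
    · rintro ⟨⟨p, c⟩, a, b⟩ h
      simp only [Finset.mem_sigma, Finset.HasAntidiagonal.mem_antidiagonal] at h ⊢
      exact ⟨by omega, trivial⟩
    · rintro ⟨⟨p, c⟩, a, b⟩ h
      simp only [Finset.mem_sigma, Finset.HasAntidiagonal.mem_antidiagonal] at h ⊢
      exact ⟨by omega, trivial⟩
    · rintro ⟨⟨p, c⟩, a, b⟩ h
      simp only [Finset.mem_sigma, Finset.HasAntidiagonal.mem_antidiagonal] at h ⊢
      obtain ⟨-, rfl⟩ := h
      rfl
    · rintro ⟨⟨p, c⟩, a, b⟩ h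
      simp only [Finset.mem_sigma, Finset.HasAntidiagonal.mem_antidiagonal] at h ⊢
      obtain ⟨-, rfl⟩ := h
      rfl
    · rintro ⟨⟨p, c⟩, a, b⟩ h
      simp only [Finset.mem_sigma, Finset.HasAntidiagonal.mem_antidiagonal] at h ⊢
      rw [M.splitAt_coassoc a b c p (b + c) n (by omega) (by omega) (by omega)]
  rTensor_counit_comp_comul := by
    apply hom_ext
    intro n x
    have h : ∀ i j (y : (M.pow (i + 1)).carrier ⊗[k] (M.pow j).carrier),
        (Coalgebra.counit (R := k)).rTensor (CotensorCoalgebra M)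
          (TensorProduct.map (incl M (i + 1)) (incl M j) y) = 0 := by
      intro i j y
      induction y with
      | zero => simp
      | add a b ha hb => simp only [map_add, ha, hb, add_zero]
      | tmul a b => simp [counit_incl_succ]
    have h₀ : ∀ j (y : C ⊗[k] (M.pow j).carrier),
        (Coalgebra.counit (R := k)).rTensor (CotensorCoalgebra M)
          (TensorProduct.map (incl M 0) (incl M j) y) =
        (incl M j).lTensor k ((Coalgebra.counit (R := k) (A := C)).rTensor _ y) := by
      intro j y
      exact LinearMap.congr_fun (TensorProduct.ext'
        (g := (Coalgebra.counit (R := k)).rTensor (CotensorCoalgebra M) ∘ₗ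
          TensorProduct.map (incl M 0 : C →ₗ[k] CotensorCoalgebra M) (incl M j))
        (h := (incl M j).lTensor k ∘ₗ (Coalgebra.counit (R := k) (A := C)).rTensor _)
        (fun a b => congrArg (· ⊗ₜ[k] incl M j b) (counit_incl_zero M a))) y
    simp only [LinearMap.comp_apply, comul_incl, map_sum]
    rw [Finset.sum_eq_single (0, n)]
    · refine (h₀ n _).trans ?_
      refine (congrArg _ (M.splitAt_counit_left n x)).trans ?_
      simp
    · rintro ⟨i, j⟩ hij hne
      obtain _ | i := i
      · simp only [Finset.HasAntidiagonal.mem_antidiagonal] at hij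
        exact absurd (by rw [← hij, Nat.zero_add]) hne
      · exact h i j _
    · simp
  lTensor_counit_comp_comul := by
    apply hom_ext
    intro n x
    have h : ∀ i j (y : (M.pow i).carrier ⊗[k] (M.pow (j + 1)).carrier),
        (Coalgebra.counit (R := k)).lTensor (CotensorCoalgebra M)
          (TensorProduct.map (incl M i) (incl M (j + 1)) y) = 0 := by
      intro i j y
      induction y with
      | zero => simp
      | add a b ha hb => simp only [map_add, ha, hb, add_zero]
      | tmul a b => simp [counit_incl_succ]
    have h₀ : ∀ i (y : (M.pow i).carrier ⊗[k] C),
        (Coalgebra.counit (R := k)).lTensor (CotensorCoalgebra M)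
          (TensorProduct.map (incl M i) (incl M 0) y) =
        (incl M i).rTensor k ((Coalgebra.counit (R := k) (A := C)).lTensor _ y) := by
      intro i y
      exact LinearMap.congr_fun (TensorProduct.ext'
        (g := (Coalgebra.counit (R := k)).lTensor (CotensorCoalgebra M) ∘ₗ
          TensorProduct.map (incl M i) (incl M 0 : C →ₗ[k] CotensorCoalgebra M))
        (h := (incl M i).rTensor k ∘ₗ (Coalgebra.counit (R := k) (A := C)).lTensor _)
        (fun a b => congrArg (incl M i a ⊗ₜ[k] ·) (counit_incl_zero M b))) y
    simp only [LinearMap.comp_apply, comul_incl, map_sum]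
    rw [Finset.sum_eq_single (n, 0)]
    · refine (h₀ n _).trans ?_
      refine (congrArg _ (M.splitAt_counit_right n x)).trans ?_
      simp
    · rintro ⟨i, j⟩ hij hne
      obtain _ | j := j
      · simp only [Finset.HasAntidiagonal.mem_antidiagonal] at hij
        exact absurd (by rw [← hij, Nat.add_zero]) hne
      · exact h i j _
    · simp

end CotensorCoalgebra

/-! ### Dual coalgebras -/

section Dual

open Module

variable {k : Type u} [Field k]

theorem dualDistrib_injective (V W : Type*) [AddCommGroup V] [Module k V] [AddCommGroup W]
    [Module k W] : Function.Injective (TensorProduct.dualDistrib k V W) := by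
  rw [injective_iff_map_eq_zero]
  intro z hz
  classical
  let b := Basis.ofVectorSpace k (Dual k W)
  obtain ⟨c, rfl⟩ := (TensorProduct.equivFinsuppOfBasisRight (M := Dual k V) b).symm.surjective z
  rw [TensorProduct.equivFinsuppOfBasisRight_symm_apply] at hz ⊢
  have hc : c = 0 := by
    ext i v
    have h0 : Finsupp.linearCombination k b (c.mapRange (fun f : Dual k V => f v) rfl) = 0 := by
      ext w
      have := LinearMap.congr_fun hz (v ⊗ₜ[k] w)
      simp only [Finsupp.sum, map_sum, LinearMap.sum_apply, TensorProduct.dualDistrib_apply,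
        LinearMap.zero_apply] at this
      rw [Finsupp.linearCombination_apply, Finsupp.sum_mapRange_index (by simp)]
      simpa [Finsupp.sum] using this
    have := (linearIndependent_iff.1 b.linearIndependent) _ h0
    simpa using DFunLike.congr_fun this i
  simp [hc]

variable {A : Type*} [Ring A] [Algebra k A] {P : Type*} [AddCommGroup P] [Module k P]

/-- An element of `P ⊗ P`, for a space `P` of functionals on `A`, as a functional on `A ⊗ A`. -/
def evalTwo (ι : P →ₗ[k] Dual k A) : P ⊗[k] P →ₗ[k] Dual k (A ⊗[k] A) :=
  TensorProduct.dualDistrib k A A ∘ₗ TensorProduct.map ι ι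

@[simp]
theorem evalTwo_tmul (ι : P →ₗ[k] Dual k A) (p q : P) (a b : A) :
    evalTwo ι (p ⊗ₜ[k] q) (a ⊗ₜ[k] b) = ι p a * ι q b := rfl

theorem evalTwo_injective (ι : P →ₗ[k] Dual k A) (hι : Function.Injective ι) :
    Function.Injective (evalTwo ι) :=
  (dualDistrib_injective A A).comp (TensorProduct.map_injective_of_flat_flat ι ι hι hι)

/-- An element of `P ⊗ (P ⊗ P)` as a functional on `A ⊗ (A ⊗ A)`. -/
def evalThree (ι : P →ₗ[k] Dual k A) :
    P ⊗[k] (P ⊗[k] P) →ₗ[k] Dual k (A ⊗[k] (A ⊗[k] A)) :=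
  TensorProduct.dualDistrib k A (A ⊗[k] A) ∘ₗ TensorProduct.map ι (evalTwo ι)

theorem evalThree_injective (ι : P →ₗ[k] Dual k A) (hι : Function.Injective ι) :
    Function.Injective (evalThree ι) :=
  (dualDistrib_injective A (A ⊗[k] A)).comp
    (TensorProduct.map_injective_of_flat_flat ι (evalTwo ι) hι (evalTwo_injective ι hι))

/-- `ρ : P → P ⊗ P` is dual to the (not necessarily associative) product `m` on `A`. -/
def IsDualTo (ι : P →ₗ[k] Dual k A) (ρ : P →ₗ[k] P ⊗[k] P) (m : A → A → A) : Prop :=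
  ∀ p a b, evalTwo ι (ρ p) (a ⊗ₜ[k] b) = ι p (m a b)

theorem IsDualTo.coassoc {ι : P →ₗ[k] Dual k A} (hι : Function.Injective ι)
    {ρ σ τ υ : P →ₗ[k] P ⊗[k] P} {mρ mσ mτ mυ : A → A → A} (hρ : IsDualTo ι ρ mρ)
    (hσ : IsDualTo ι σ mσ) (hτ : IsDualTo ι τ mτ) (hυ : IsDualTo ι υ mυ)
    (h : ∀ a b c, mρ (mσ a b) c = mτ a (mυ b c)) (p : P) :
    TensorProduct.assoc k P P P (σ.rTensor P (ρ p)) = υ.lTensor P (τ p) := by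
  apply evalThree_injective ι hι
  have hL : ∀ (z : P ⊗[k] P) (a b c : A), evalThree ι (TensorProduct.assoc k P P P (σ.rTensor P z))
      (a ⊗ₜ[k] (b ⊗ₜ[k] c)) = evalTwo ι z (mσ a b ⊗ₜ[k] c) := by
    intro z a b c
    induction z with
    | zero => simp
    | add x y hx hy => simp only [map_add, LinearMap.add_apply, hx, hy]
    | tmul x y =>
      rw [evalTwo_tmul, ← hσ x a b, LinearMap.rTensor_tmul]
      generalize σ x = w
      induction w with
      | zero => simp
      | add u v hu hv =>
        simp only [TensorProduct.add_tmul, map_add, LinearMap.add_apply, hu, hv, add_mul]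
      | tmul u v => exact (mul_assoc (ι u a) (ι v b) (ι y c)).symm
  have hR : ∀ (z : P ⊗[k] P) (a b c : A), evalThree ι (υ.lTensor P z)
      (a ⊗ₜ[k] (b ⊗ₜ[k] c)) = evalTwo ι z (a ⊗ₜ[k] mυ b c) := by
    intro z a b c
    induction z with
    | zero => simp
    | add x y hx hy => simp only [map_add, LinearMap.add_apply, hx, hy]
    | tmul x y =>
      rw [evalTwo_tmul, ← hυ y b c]
      rfl
  refine TensorProduct.ext (LinearMap.ext fun a => TensorProduct.ext' fun b c => ?_)
  change evalThree ι _ (a ⊗ₜ[k] (b ⊗ₜ[k] c)) = evalThree ι _ (a ⊗ₜ[k] (b ⊗ₜ[k] c))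
  rw [hL, hR, hρ, hτ, h]

theorem IsDualTo.counit_left {ι : P →ₗ[k] Dual k A} (hι : Function.Injective ι)
    {ρ : P →ₗ[k] P ⊗[k] P} {m : A → A → A} (hρ : IsDualTo ι ρ m) (h : ∀ a, m 1 a = a) (p : P) :
    (LinearMap.applyₗ (1 : A) ∘ₗ ι : P →ₗ[k] k).rTensor P (ρ p) = 1 ⊗ₜ[k] p := by
  apply (TensorProduct.lid k P).injective
  apply hι
  ext a
  have key : ∀ z : P ⊗[k] P, ι (TensorProduct.lid k P
      ((LinearMap.applyₗ (1 : A) ∘ₗ ι : P →ₗ[k] k).rTensor P z)) a =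
      evalTwo ι z ((1 : A) ⊗ₜ[k] a) := by
    intro z
    induction z with
    | zero => simp
    | add x y hx hy => simp only [map_add, LinearMap.add_apply, hx, hy]
    | tmul x y => simp
  rw [key, hρ, h]
  simp

theorem IsDualTo.counit_right {ι : P →ₗ[k] Dual k A} (hι : Function.Injective ι)
    {ρ : P →ₗ[k] P ⊗[k] P} {m : A → A → A} (hρ : IsDualTo ι ρ m) (h : ∀ a, m a 1 = a) (p : P) :
    (LinearMap.applyₗ (1 : A) ∘ₗ ι : P →ₗ[k] k).lTensor P (ρ p) = p ⊗ₜ[k] 1 := by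
  apply (TensorProduct.rid k P).injective
  apply hι
  ext a
  have key : ∀ z : P ⊗[k] P, ι (TensorProduct.rid k P
      ((LinearMap.applyₗ (1 : A) ∘ₗ ι : P →ₗ[k] k).lTensor P z)) a =
      evalTwo ι z (a ⊗ₜ[k] (1 : A)) := by
    intro z
    induction z with
    | zero => simp
    | add x y hx hy => simp only [map_add, LinearMap.add_apply, hx, hy]
    | tmul x y => simp [mul_comm]
  rw [key, hρ, h]
  simp

/-- The comultiplication on a space `P` of functionals on an algebra `A`, such that for each `f ∈ P`
the functional `a ⊗ b ↦ f (a b)` lies in `P ⊗ P`: `Δ f = ∑ fᵢ ⊗ gᵢ` is determined by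
`f (a b) = ∑ fᵢ(a) gᵢ(b)`. -/
def comulOfFunctionals (ι : P →ₗ[k] Dual k A) (hι : Function.Injective ι)
    (H : ∀ p, (LinearMap.mul' k A).dualMap (ι p) ∈ LinearMap.range (evalTwo ι)) :
    P →ₗ[k] P ⊗[k] P :=
  LinearMap.codRestrictOfInjective ((LinearMap.mul' k A).dualMap ∘ₗ ι) (evalTwo ι)
    (evalTwo_injective ι hι) H

theorem comulOfFunctionals_isDualTo (ι : P →ₗ[k] Dual k A) (hι : Function.Injective ι)
    (H : ∀ p, (LinearMap.mul' k A).dualMap (ι p) ∈ LinearMap.range (evalTwo ι)) :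
    IsDualTo ι (comulOfFunctionals ι hι H) (fun a b => a * b) := fun p a b => by
  rw [comulOfFunctionals, LinearMap.codRestrictOfInjective_comp_apply]
  simp

/-- The coalgebra structure on such a space `P`, with counit `ε f = f 1`. -/
@[reducible]
def coalgebraOfFunctionals (ι : P →ₗ[k] Dual k A) (hι : Function.Injective ι)
    (H : ∀ p, (LinearMap.mul' k A).dualMap (ι p) ∈ LinearMap.range (evalTwo ι)) :
    Coalgebra k P where
  comul := comulOfFunctionals ι hι H
  counit := LinearMap.applyₗ (1 : A) ∘ₗ ι
  coassoc :=
    have h := comulOfFunctionals_isDualTo ι hι H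
    LinearMap.ext (h.coassoc hι h h h mul_assoc)
  rTensor_counit_comp_comul :=
    LinearMap.ext ((comulOfFunctionals_isDualTo ι hι H).counit_left hι one_mul)
  lTensor_counit_comp_comul :=
    LinearMap.ext ((comulOfFunctionals_isDualTo ι hι H).counit_right hι mul_one)

theorem mem_range_evalTwo_id (k : Type u) [Field k] (D : Type v) [Ring D] [Algebra k D]
    [FiniteDimensional k D] (φ : Dual k (D ⊗[k] D)) :
    φ ∈ LinearMap.range (evalTwo (k := k) (A := D) LinearMap.id) :=
  ⟨(TensorProduct.dualDistribEquiv k D D).symm φ, by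
    rw [evalTwo, TensorProduct.map_id, LinearMap.comp_id]
    exact (TensorProduct.dualDistribEquiv k D D).apply_symm_apply φ⟩

/-- The dual coalgebra `D^*` of a finite-dimensional algebra `D`. -/
instance dualCoalgebra (k : Type u) [Field k] (D : Type v) [Ring D] [Algebra k D]
    [FiniteDimensional k D] : Coalgebra k (Dual k D) :=
  coalgebraOfFunctionals (P := Dual k D) LinearMap.id Function.injective_id
    (fun _ => mem_range_evalTwo_id k D _)

theorem dualCoalgebra_isDualTo (k : Type u) [Field k] (D : Type v) [Ring D] [Algebra k D]
    [FiniteDimensional k D] :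
    IsDualTo (A := D) (P := Dual k D) LinearMap.id (Coalgebra.comul (R := k) (A := Dual k D))
      (fun a b => a * b) :=
  comulOfFunctionals_isDualTo (A := D) (P := Dual k D) LinearMap.id Function.injective_id
    (fun _ => mem_range_evalTwo_id k D _)

/-- The finite dual `A° ⊆ A^*`: the functionals that vanish on some two-sided ideal of finite
codimension. -/
def finiteDual (k : Type u) [Field k] (A : Type v) [Ring A] [Algebra k A] :
    Submodule k (Dual k A) where
  carrier := {f | ∃ I : Ideal A, I.IsTwoSided ∧ FiniteDimensional k (A ⧸ I.restrictScalars k) ∧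
    ∀ a ∈ I, f a = 0}
  zero_mem' := by
    refine ⟨⊤, inferInstance, ?_, fun _ _ => rfl⟩
    exact (Submodule.CoFG.top : (⊤ : Submodule k A).CoFG)
  add_mem' := by
    rintro f g ⟨I, hI, hI', hf⟩ ⟨J, hJ, hJ', hg⟩
    refine ⟨I ⊓ J, ⟨fun b h => ⟨I.mul_mem_right b h.1, J.mul_mem_right b h.2⟩⟩, ?_, ?_⟩
    · exact Submodule.CoFG.inf (S := I.restrictScalars k) (T := J.restrictScalars k) hI' hJ'
    · intro a ha
      rw [LinearMap.add_apply, hf a ha.1, hg a ha.2, add_zero]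
  smul_mem' := by
    rintro c f ⟨I, hI, hI', hf⟩
    exact ⟨I, hI, hI', fun a ha => by rw [LinearMap.smul_apply, hf a ha, smul_zero]⟩

/-- The finite dual `A°` as a type. -/
def FiniteDual (k : Type u) [Field k] (A : Type v) [Ring A] [Algebra k A] : Type (max u v) :=
  finiteDual k A

instance (k : Type u) [Field k] (A : Type v) [Ring A] [Algebra k A] :
    AddCommGroup (FiniteDual k A) :=
  inferInstanceAs (AddCommGroup (finiteDual k A))

instance (k : Type u) [Field k] (A : Type v) [Ring A] [Algebra k A] :
    Module k (FiniteDual k A) :=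
  inferInstanceAs (Module k (finiteDual k A))

/-- The inclusion `A° → A^*`. -/
def FiniteDual.incl (k : Type u) [Field k] (A : Type v) [Ring A] [Algebra k A] :
    FiniteDual k A →ₗ[k] Dual k A :=
  (finiteDual k A).subtype

theorem FiniteDual.incl_injective (k : Type u) [Field k] (A : Type v) [Ring A] [Algebra k A] :
    Function.Injective (FiniteDual.incl k A) :=
  Submodule.injective_subtype _

theorem FiniteDual.mem_range_evalTwo (k : Type u) [Field k] (A : Type v) [Ring A] [Algebra k A]
    (f : FiniteDual k A) :
    (LinearMap.mul' k A).dualMap (FiniteDual.incl k A f) ∈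
      LinearMap.range (evalTwo (FiniteDual.incl k A)) := by
  obtain ⟨f, I, hI, hI', hf⟩ := f
  let π : A →ₗ[k] (A ⧸ I.restrictScalars k) := (I.restrictScalars k).mkQ
  obtain ⟨s, hs⟩ := π.exists_rightInverse_of_surjective (Submodule.range_mkQ _)
  have hs' : ∀ a, a - s (π a) ∈ I := fun a => by
    change a - s (π a) ∈ I.restrictScalars k
    rw [← Submodule.Quotient.mk_eq_zero, Submodule.Quotient.mk_sub, sub_eq_zero]
    exact (LinearMap.congr_fun hs (π a)).symm
  let r : Dual k (A ⧸ I.restrictScalars k) →ₗ[k] FiniteDual k A :=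
    LinearMap.codRestrict (finiteDual k A) π.dualMap (fun g => ⟨I, hI, hI', fun a ha => by
      change g (π a) = 0
      rw [show π a = 0 from (Submodule.Quotient.mk_eq_zero _).2 ha, map_zero]⟩)
  let w := (TensorProduct.dualDistribEquiv k _ _).symm
    (f ∘ₗ LinearMap.mul' k A ∘ₗ TensorProduct.map s s)
  refine ⟨TensorProduct.map r r w, TensorProduct.ext' fun a b => ?_⟩
  have key : ∀ z, evalTwo (FiniteDual.incl k A) (TensorProduct.map r r z) (a ⊗ₜ[k] b) =
      TensorProduct.dualDistrib k _ _ z (π a ⊗ₜ[k] π b) := by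
    intro z
    induction z with
    | zero => simp
    | add x y hx hy => simp only [map_add, LinearMap.add_apply, hx, hy]
    | tmul x y => rfl
  rw [key]
  have hw : TensorProduct.dualDistrib k _ _ w = f ∘ₗ LinearMap.mul' k A ∘ₗ TensorProduct.map s s :=
    (TensorProduct.dualDistribEquiv k _ _).apply_symm_apply _
  rw [hw]
  change f (s (π a) * s (π b)) = f (a * b)
  rw [eq_comm, ← sub_eq_zero, ← map_sub]
  apply hf
  have : a * b - s (π a) * s (π b) = (a - s (π a)) * b + s (π a) * (b - s (π b)) := by
    noncomm_ring
  rw [this]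
  exact I.add_mem (I.mul_mem_right _ (hs' a)) (I.mul_mem_left _ (hs' b))

/-- The finite dual coalgebra `A°`. -/
instance finiteDualCoalgebra (k : Type u) [Field k] (A : Type v) [Ring A] [Algebra k A] :
    Coalgebra k (FiniteDual k A) :=
  coalgebraOfFunctionals (FiniteDual.incl k A) (FiniteDual.incl_injective k A)
    (FiniteDual.mem_range_evalTwo k A)

theorem finiteDualCoalgebra_isDualTo (k : Type u) [Field k] (A : Type v) [Ring A] [Algebra k A] :
    IsDualTo (FiniteDual.incl k A) (Coalgebra.comul (R := k)) (fun a b => a * b) :=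
  comulOfFunctionals_isDualTo (FiniteDual.incl k A) (FiniteDual.incl_injective k A)
    (FiniteDual.mem_range_evalTwo k A)

theorem finiteDualCoalgebra_counit (k : Type u) [Field k] (A : Type v) [Ring A] [Algebra k A]
    (f : FiniteDual k A) : Coalgebra.counit (R := k) f = FiniteDual.incl k A f 1 := rfl

/-! ### The coalgebra `DC(D, α)` -/

variable (k) in
/-- The `D^*`-bicomodule `(D_α)^*` dual to the `D`-bimodule `D_α`, which is `D` with the actions
`a ▹ x = a x` and `x ◃ b = x α(b)`. The left coaction is dual to `▹` and the right coaction is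
dual to `◃`. -/
def twistedDual {D : Type v} [Ring D] [Algebra k D] [FiniteDimensional k D] (α : D ≃ₐ[k] D) :
    Bicomodule k (Dual k D) :=
  have hl := dualCoalgebra_isDualTo k D
  have hr : IsDualTo (A := D) LinearMap.id (α.toLinearMap.dualMap.lTensor (Dual k D) ∘ₗ
      Coalgebra.comul (R := k) (A := Dual k D)) (fun x b => x * α b) := fun p x b => by
    rw [← hl p x (α b), LinearMap.comp_apply]
    generalize Coalgebra.comul (R := k) p = z
    induction z with
    | zero => simp
    | add x y hx hy => simp only [map_add, LinearMap.add_apply, hx, hy]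
    | tmul x y => rfl
  { carrier := Dual k D
    lco := Coalgebra.comul
    rco := α.toLinearMap.dualMap.lTensor (Dual k D) ∘ₗ Coalgebra.comul
    lco_coassoc := Coalgebra.coassoc_apply
    lco_counit := Coalgebra.rTensor_counit_comul
    rco_coassoc := hr.coassoc Function.injective_id hr hr hl (fun x b c => by
      rw [map_mul, mul_assoc])
    rco_counit := hr.counit_right Function.injective_id (fun x => by rw [map_one, mul_one])
    lco_rco := hr.coassoc Function.injective_id hl hl hr (fun a x b => mul_assoc a x (α b)) }

variable (k) in
/-- The coalgebra `DC(D, α) = T_{D^*}((D_α)^*)`. -/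
abbrev DC {D : Type v} [DivisionRing D] [Algebra k D] [FiniteDimensional k D] (α : D ≃ₐ[k] D) :
    Type (max u v) :=
  CotensorCoalgebra (twistedDual k α)

end Dual

end

/-! Since `D` is finite-dimensional, elements of `D^* ⊗ D^*` are the same as bilinear forms on `D`.
If `M` is `D^*` with its regular coactions, an element `z` of `M □ M` is a form with `z(ab, c) =
z(a, bc)`. Taking `a = 1` shows that such a form is determined by the functional `c ↦ z(1, c)`, and
conversely every functional `f` gives the balanced form `(a, b) ↦ f(ab)`. Hence `M □ M ≅ D^*`, and
by induction every cotensor power is a copy of `D^*` (`cotensorEval_bijective`,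
`powEval_bijective`). Under these identifications each component `M^{□ n} → M^{□ i} ⊗ M^{□ j}` of
the comultiplication is the transpose of the product of `D` (`isMulDual_splitAt`).

So the cotensor coalgebra is a direct sum of copies of `D^*`, one for each degree, where `f` in
degree `n` has comultiplication `∑_{i+j=n} f(ab)` with `a` in degree `i` and `b` in degree `j`. This
is the transpose of the Cauchy product, so sending `f` in degree `n` to `p ↦ f(pₙ)` is a coalgebra
map into `D[[x]]°`. It is injective because monomials separate the degrees. It is surjective because
an ideal of finite codimension is nonzero, and a nonzero two-sided ideal of `D[[x]]` contains a
power of `x` when `D` is a division ring (`exists_X_pow_mem`). A functional in the finite dual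
therefore sees only finitely many coefficients. -/

namespace FunctionalPairing

/-! ### Tensors as multilinear functionals. -/

open Module

variable {k : Type*} [Field k] {A : Type*} [Ring A] [Algebra k A] {V W U X : Type*}
  [AddCommGroup V] [Module k V] [AddCommGroup W] [Module k W]
  [AddCommGroup U] [Module k U] [AddCommGroup X] [Module k X]

/-- An element of `V ⊗ W` as a functional on `A ⊗ A`, where `f` and `g` interpret the elements of
`V` and `W` as functionals on `A`. -/
noncomputable def pairing (f : V →ₗ[k] Dual k A) (g : W →ₗ[k] Dual k A) :
    V ⊗[k] W →ₗ[k] Dual k (A ⊗[k] A) :=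
  TensorProduct.dualDistrib k A A ∘ₗ TensorProduct.map f g

@[simp]
theorem pairing_tmul (f : V →ₗ[k] Dual k A) (g : W →ₗ[k] Dual k A) (v : V) (w : W) (a b : A) :
    pairing f g (v ⊗ₜ[k] w) (a ⊗ₜ[k] b) = f v a * g w b := rfl

theorem pairing_injective {f : V →ₗ[k] Dual k A} {g : W →ₗ[k] Dual k A}
    (hf : Function.Injective f) (hg : Function.Injective g) : Function.Injective (pairing f g) :=
  (dualDistrib_injective A A).comp (TensorProduct.map_injective_of_flat_flat f g hf hg)

/-- Finite dimension makes `A^* ⊗ A^* → (A ⊗ A)^*` onto. This later supplies a tensor representing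
the form `(a, b) ↦ f(ab)`. -/
theorem pairing_surjective [FiniteDimensional k A] {f : V →ₗ[k] Dual k A} {g : W →ₗ[k] Dual k A}
    (hf : Function.Surjective f) (hg : Function.Surjective g) :
    Function.Surjective (pairing f g) :=
  (TensorProduct.dualDistribEquiv k A A).surjective.comp (TensorProduct.map_surjective hf hg)

/-- An element of `V ⊗ (W ⊗ U)` as a functional on `A ⊗ (A ⊗ A)`. -/
noncomputable def pairingThree (f : V →ₗ[k] Dual k A) (g : W →ₗ[k] Dual k A)
    (h : U →ₗ[k] Dual k A) : V ⊗[k] (W ⊗[k] U) →ₗ[k] Dual k (A ⊗[k] (A ⊗[k] A)) :=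
  TensorProduct.dualDistrib k A (A ⊗[k] A) ∘ₗ TensorProduct.map f (pairing g h)

theorem pairingThree_tmul (f : V →ₗ[k] Dual k A) (g : W →ₗ[k] Dual k A) (h : U →ₗ[k] Dual k A)
    (v : V) (z : W ⊗[k] U) (a b c : A) :
    pairingThree f g h (v ⊗ₜ[k] z) (a ⊗ₜ[k] (b ⊗ₜ[k] c)) =
      f v a * pairing g h z (b ⊗ₜ[k] c) := rfl

theorem pairingThree_injective {f : V →ₗ[k] Dual k A} {g : W →ₗ[k] Dual k A}
    {h : U →ₗ[k] Dual k A} (hf : Function.Injective f) (hg : Function.Injective g)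
    (hh : Function.Injective h) : Function.Injective (pairingThree f g h) :=
  (dualDistrib_injective A (A ⊗[k] A)).comp
    (TensorProduct.map_injective_of_flat_flat f (pairing g h) hf (pairing_injective hg hh))

/-- The map `d : X → V ⊗ W` is dual to the multiplication of `A`. -/
def IsMulDual (e : X →ₗ[k] Dual k A) (f : V →ₗ[k] Dual k A) (g : W →ₗ[k] Dual k A)
    (d : X →ₗ[k] V ⊗[k] W) : Prop :=
  ∀ x a b, pairing f g (d x) (a ⊗ₜ[k] b) = e x (a * b)

/-- Splitting one leg of a tensor amounts to multiplying the corresponding two arguments. Together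
with `pairingThree_rTensor`, this turns identities between coactions into identities between
products in `A`. -/
theorem IsMulDual.pairingThree_lTensor {e : X →ₗ[k] Dual k A} {g : W →ₗ[k] Dual k A}
    {h : U →ₗ[k] Dual k A} {d : X →ₗ[k] W ⊗[k] U} (hd : IsMulDual e g h d)
    (f : V →ₗ[k] Dual k A) (z : V ⊗[k] X) (a b c : A) :
    pairingThree f g h (d.lTensor V z) (a ⊗ₜ[k] (b ⊗ₜ[k] c)) =
      pairing f e z (a ⊗ₜ[k] (b * c)) := by
  induction z with
  | zero => simp
  | add x y hx hy => simp only [map_add, LinearMap.add_apply, hx, hy]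
  | tmul x y => rw [LinearMap.lTensor_tmul, pairingThree_tmul, hd, pairing_tmul]

theorem IsMulDual.pairingThree_rTensor {e : X →ₗ[k] Dual k A} {f : V →ₗ[k] Dual k A}
    {g : W →ₗ[k] Dual k A} {d : X →ₗ[k] V ⊗[k] W} (hd : IsMulDual e f g d)
    (h : U →ₗ[k] Dual k A) (z : X ⊗[k] U) (a b c : A) :
    pairingThree f g h (TensorProduct.assoc k V W U (d.rTensor U z)) (a ⊗ₜ[k] (b ⊗ₜ[k] c)) =
      pairing e h z ((a * b) ⊗ₜ[k] c) := by
  induction z with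
  | zero => simp
  | add x y hx hy => simp only [map_add, LinearMap.add_apply, hx, hy]
  | tmul x y =>
    rw [pairing_tmul, ← hd x a b, LinearMap.rTensor_tmul]
    generalize d x = w
    induction w with
    | zero => simp
    | add p q hp hq =>
      simp only [TensorProduct.add_tmul, map_add, LinearMap.add_apply, hp, hq, add_mul]
    | tmul p q => exact (mul_assoc (f p a) (g q b) (h y c)).symm

end FunctionalPairing

/-! ### Cotensor powers of the regular bicomodule. -/

namespace Bicomodule

open Module FunctionalPairing

variable {k : Type u} [Field k] {D : Type v} [Ring D] [Algebra k D] [FiniteDimensional k D]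
  {M N N' : Bicomodule k (Dual k D)}

/-- A functional on `D` for each element of `M □ N`, by evaluating at `1 ⊗ b`. -/
noncomputable def cotensorEval (e : M.carrier →ₗ[k] Dual k D) (e' : N.carrier →ₗ[k] Dual k D) :
    cotensorSpace M N →ₗ[k] Dual k D :=
  (TensorProduct.mk k D D 1).dualMap ∘ₗ pairing e e' ∘ₗ (cotensorSpace M N).subtype

theorem cotensorEval_apply (e : M.carrier →ₗ[k] Dual k D) (e' : N.carrier →ₗ[k] Dual k D)
    (x : cotensorSpace M N) (b : D) :
    cotensorEval e e' x b = pairing e e' x ((1 : D) ⊗ₜ[k] b) := rfl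

variable {e : M.carrier →ₗ[k] Dual k D} {e' : N.carrier →ₗ[k] Dual k D}

/-- The equalizer condition evaluated at `(1, a, b)`: coacting on the left factor gives `x(1 * a,
b)`, coacting on the right factor gives `x(1, a * b)`. -/
theorem pairing_cotensor (hr : IsMulDual e e LinearMap.id M.rco)
    (hl : IsMulDual e' LinearMap.id e' N.lco) (x : cotensorSpace M N) (a b : D) :
    pairing e e' x (a ⊗ₜ[k] b) = cotensorEval e e' x (a * b) := by
  have hx : cotensorLeft M N x = cotensorRight M N x := x.2
  have h1 := hr.pairingThree_rTensor e' (x : M.carrier ⊗[k] N.carrier) 1 a b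
  have h2 := hl.pairingThree_lTensor e (x : M.carrier ⊗[k] N.carrier) 1 a b
  rw [one_mul] at h1
  rw [← h1, cotensorEval_apply, ← h2]
  exact congrArg (fun z => pairingThree e LinearMap.id e' z _) hx

/-- Injectivity holds because a balanced form is determined by its values at `(1, b)`. For
surjectivity, the preimage of `f` is the form `(a, b) ↦ f(ab)`, which is balanced by associativity.
-/
theorem cotensorEval_bijective (he : Function.Bijective e) (he' : Function.Bijective e')
    (hr : IsMulDual e e LinearMap.id M.rco) (hl : IsMulDual e' LinearMap.id e' N.lco) :
    Function.Bijective (cotensorEval e e') := by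
  constructor
  · intro x y hxy
    apply Subtype.ext
    apply pairing_injective he.1 he'.1
    refine TensorProduct.ext' fun a b => ?_
    rw [pairing_cotensor hr hl, pairing_cotensor hr hl, hxy]
  · intro f
    obtain ⟨z, hz⟩ := pairing_surjective he.2 he'.2 (f ∘ₗ LinearMap.mul' k D)
    have hz' : ∀ a b : D, pairing e e' z (a ⊗ₜ[k] b) = f (a * b) := fun a b => by
      rw [hz]; simp
    refine ⟨⟨z, ?_⟩, LinearMap.ext fun b => ?_⟩
    -- Membership in the equalizer, tested on triples, reads `f((ab)c) = f(a(bc))`.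
    · apply pairingThree_injective he.1 (g := LinearMap.id) Function.injective_id he'.1
      refine TensorProduct.ext (LinearMap.ext fun a => TensorProduct.ext' fun b c => ?_)
      refine (hr.pairingThree_rTensor e' z a b c).trans
        (Eq.trans ?_ (hl.pairingThree_lTensor e z a b c).symm)
      rw [hz', hz', mul_assoc]
    · rw [cotensorEval_apply, hz', one_mul]

theorem isMulDual_subtype (hr : IsMulDual e e LinearMap.id M.rco)
    (hl : IsMulDual e' LinearMap.id e' N.lco) :
    IsMulDual (cotensorEval e e') e e' (cotensorSpace M N).subtype :=
  pairing_cotensor hr hl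

/-- The coaction splits the first factor, so its value at `(a, b)` is `x(a * 1, b)`, the `1` being
the argument inserted by `cotensorEval`. Balancedness moves `a` to the second argument. -/
theorem isMulDual_cotensorLco (hr : IsMulDual e e LinearMap.id M.rco)
    (hl : IsMulDual e LinearMap.id e M.lco) (hl' : IsMulDual e' LinearMap.id e' N.lco) :
    IsMulDual (cotensorEval e e') LinearMap.id (cotensorEval e e') (cotensorLco M N) := by
  intro x a b
  have key : ∀ z : Dual k D ⊗[k] cotensorSpace M N,
      pairing LinearMap.id (cotensorEval e e') z (a ⊗ₜ[k] b) =
        pairingThree LinearMap.id e e' ((cotensorSpace M N).subtype.lTensor (Dual k D) z)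
          (a ⊗ₜ[k] ((1 : D) ⊗ₜ[k] b)) := by
    intro z
    induction z with
    | zero => simp
    | add x y hx hy => simp only [map_add, LinearMap.add_apply, hx, hy]
    | tmul x y => rfl
  rw [key, cotensorLco_spec]
  refine (hl.pairingThree_rTensor e' (x : M.carrier ⊗[k] N.carrier) a 1 b).trans ?_
  rw [mul_one, pairing_cotensor hr hl']

/-- The factor in `M` is a spectator evaluated at `1`, while `d` splits the second factor. This is
the induction step for `split`. -/
theorem isMulDual_cotensorMap {U : Type*} [AddCommGroup U] [Module k U]
    {f : N'.carrier →ₗ[k] Dual k D} {h : U →ₗ[k] Dual k D}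
    {d : N.carrier →ₗ[k] N'.carrier ⊗[k] U} (hd : IsLeftColinear d) (hd' : IsMulDual e' f h d) :
    IsMulDual (cotensorEval e e') (cotensorEval e f) h (cotensorMap M d hd) := by
  intro x a b
  have key : ∀ z : cotensorSpace M N' ⊗[k] U,
      pairing (cotensorEval e f) h z (a ⊗ₜ[k] b) =
        pairingThree e f h (TensorProduct.assoc k M.carrier N'.carrier U
          ((cotensorSpace M N').subtype.rTensor U z)) ((1 : D) ⊗ₜ[k] (a ⊗ₜ[k] b)) := by
    intro z
    induction z with
    | zero => simp
    | add x y hx hy => simp only [map_add, LinearMap.add_apply, hx, hy]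
    | tmul x y =>
      rw [pairing_tmul, cotensorEval_apply, LinearMap.rTensor_tmul, Submodule.subtype_apply]
      generalize (x : M.carrier ⊗[k] N'.carrier) = w
      induction w with
      | zero => simp
      | add p q hp hq =>
        simp only [TensorProduct.add_tmul, map_add, LinearMap.add_apply, ← hp, ← hq, add_mul]
      | tmul p q => exact mul_assoc (e p 1) (f q a) (h y b)
  rw [key, cotensorMap_spec, assoc_tensorMap, hd'.pairingThree_lTensor, cotensorEval_apply]

/-- The elements of the cotensor powers of `M` as functionals on `D`. -/
noncomputable def powEval (e : M.carrier →ₗ[k] Dual k D) :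
    (n : ℕ) → (pow M n).carrier →ₗ[k] Dual k D
  | 0 => LinearMap.id (M := Dual k D)
  | 1 => e
  | n + 2 => cotensorEval e (powEval e (n + 1))

theorem isMulDual_comul (k : Type u) [Field k] (D : Type v) [Ring D] [Algebra k D]
    [FiniteDimensional k D] :
    IsMulDual (A := D) (X := Dual k D) LinearMap.id LinearMap.id LinearMap.id
      (Coalgebra.comul (R := k) (A := Dual k D)) :=
  dualCoalgebra_isDualTo k D

theorem isMulDual_pow_lco (hr : IsMulDual e e LinearMap.id M.rco)
    (hl : IsMulDual e LinearMap.id e M.lco) : ∀ n,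
    IsMulDual (powEval e n) LinearMap.id (powEval e n) (pow M n).lco
  | 0 => isMulDual_comul k D
  | 1 => hl
  | n + 2 => isMulDual_cotensorLco hr hl (isMulDual_pow_lco hr hl (n + 1))

theorem powEval_bijective (he : Function.Bijective e) (hr : IsMulDual e e LinearMap.id M.rco)
    (hl : IsMulDual e LinearMap.id e M.lco) : ∀ n, Function.Bijective (powEval e n)
  | 0 => Function.bijective_id
  | 1 => he
  | n + 2 => cotensorEval_bijective he (powEval_bijective he hr hl (n + 1)) hr
      (isMulDual_pow_lco hr hl (n + 1))

/-- The cases follow the recursion of `split`. In the case `(1, j + 1)` the splitting map is the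
inclusion of the cotensor product, and the claim is exactly that its elements are balanced. -/
theorem isMulDual_split (hr : IsMulDual e e LinearMap.id M.rco)
    (hl : IsMulDual e LinearMap.id e M.lco) : ∀ i j,
    IsMulDual (powEval e (j + i)) (powEval e i) (powEval e j) (split M i j).1
  | 0, j => isMulDual_pow_lco hr hl j
  | 1, 0 => hr
  | 1, j + 1 => isMulDual_subtype hr (isMulDual_pow_lco hr hl (j + 1))
  | i + 2, j => isMulDual_cotensorMap (split M (i + 1) j).2 (isMulDual_split hr hl (i + 1) j)

theorem isMulDual_splitAt (hr : IsMulDual e e LinearMap.id M.rco)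
    (hl : IsMulDual e LinearMap.id e M.lco) {i j n : ℕ} (h : i + j = n) :
    IsMulDual (powEval e n) (powEval e i) (powEval e j) (splitAt M i j n) := by
  -- `split` is indexed by `j + i`, while the antidiagonal supplies `i + j = n`.
  obtain rfl : j + i = n := by rw [← h, add_comm]
  rw [splitAt_eq]
  exact isMulDual_split hr hl i j

/-- The elements of the bicomodule `(D_α)^*` as functionals on `D`. -/
noncomputable def twistedDualEval (α : D ≃ₐ[k] D) :
    (twistedDual k α).carrier →ₗ[k] Dual k D :=
  LinearMap.id (M := Dual k D)

theorem isMulDual_twistedDual_lco (α : D ≃ₐ[k] D) :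
    IsMulDual (twistedDualEval α) LinearMap.id (twistedDualEval α) (twistedDual k α).lco :=
  isMulDual_comul k D

theorem isMulDual_twistedDual_rco :
    IsMulDual (twistedDualEval (AlgEquiv.refl : D ≃ₐ[k] D)) (twistedDualEval AlgEquiv.refl)
      LinearMap.id (twistedDual k (AlgEquiv.refl : D ≃ₐ[k] D)).rco := by
  have h : (twistedDual k (AlgEquiv.refl : D ≃ₐ[k] D)).rco =
      Coalgebra.comul (R := k) (A := Dual k D) :=
    -- For `α = id` the twist is by the transpose of the identity, which is the identity by
    -- unfolding.
    LinearMap.ext fun x => (LinearMap.congr_fun (LinearMap.lTensor_id (R := k) (Dual k D) (Dual k D))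
      (Coalgebra.comul (R := k) x) :)
  rw [h]
  exact isMulDual_comul k D

end Bicomodule

/-! ### The finite dual of a power series ring. -/

namespace PowerSeries

open Module

variable {k : Type u} [Field k]

/-- The `k`-linear coefficient maps of power series over a `k`-algebra. -/
noncomputable def coeffLinear (k : Type u) [Field k] (A : Type v) [Ring A] [Algebra k A] (n : ℕ) :
    PowerSeries A →ₗ[k] A where
  toFun p := coeff n p
  map_add' := map_add _
  map_smul' _ _ := rfl

@[simp]
theorem coeffLinear_apply {A : Type v} [Ring A] [Algebra k A] (n : ℕ) (p : PowerSeries A) :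
    coeffLinear k A n p = coeff n p := rfl

/-- The `k`-linear monomial maps of power series over a `k`-algebra. -/
noncomputable def monomialLinear (k : Type u) [Field k] (A : Type v) [Ring A] [Algebra k A]
    (n : ℕ) : A →ₗ[k] PowerSeries A where
  toFun a := monomial n a
  map_add' := map_add _
  map_smul' c a := by
    ext m
    rw [RingHom.id_apply, coeff_monomial,
      show coeff m (c • monomial n a) = c • coeff m (monomial n a) from rfl, coeff_monomial]
    split_ifs <;> simp

@[simp]
theorem monomialLinear_apply {A : Type v} [Ring A] [Algebra k A] (n : ℕ) (a : A) :
    monomialLinear k A n a = monomial n a := rfl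

/-- The two-sided ideal of the power series divisible by `X ^ n`. -/
def idealXPow (A : Type v) [Ring A] (n : ℕ) : Ideal (PowerSeries A) where
  carrier := {p | X ^ n ∣ p}
  zero_mem' := dvd_zero _
  add_mem' := dvd_add
  smul_mem' a p := by
    rintro ⟨q, rfl⟩
    -- `X ^ n` is central, so it can be pulled to the left of `a`.
    exact ⟨a * q, by rw [smul_eq_mul, ← mul_assoc, ← mul_assoc, X_pow_mul]⟩

theorem mem_idealXPow {A : Type v} [Ring A] {n : ℕ} {p : PowerSeries A} :
    p ∈ idealXPow A n ↔ ∀ m < n, coeff m p = 0 := X_pow_dvd_iff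

instance (A : Type v) [Ring A] (n : ℕ) : (idealXPow A n).IsTwoSided :=
  ⟨fun b h => dvd_mul_of_dvd_left h b⟩

/-- The ideal is the kernel of the map to `Aⁿ` reading off the first `n` coefficients. -/
theorem finiteDimensional_quotient_idealXPow (k : Type u) [Field k] (A : Type v) [Ring A]
    [Algebra k A] [FiniteDimensional k A] (n : ℕ) :
    FiniteDimensional k (PowerSeries A ⧸ (idealXPow A n).restrictScalars k) := by
  have h : (idealXPow A n).restrictScalars k =
      LinearMap.ker (LinearMap.pi fun i : Fin n => coeffLinear k A i) := by
    ext p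
    rw [Submodule.restrictScalars_mem, mem_idealXPow, LinearMap.mem_ker]
    exact ⟨fun h => funext fun i => h i i.2, fun h m hm => congrFun h ⟨m, hm⟩⟩
  rw [h]
  exact (LinearMap.quotKerEquivRange _).symm.finiteDimensional

/-- A nonzero `p` in `I` is `X ^ n * q`, with `n` its order and the constant coefficient of `q`
nonzero. Over a division ring `q` then has a right inverse, and multiplying `p` by it on the right
leaves `X ^ n` in `I`. -/
theorem exists_X_pow_mem {D : Type v} [DivisionRing D] {I : Ideal (PowerSeries D)}
    [I.IsTwoSided] (hI : I ≠ ⊥) : ∃ n, X ^ n ∈ I := by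
  obtain ⟨p, hp, hp0⟩ := Submodule.exists_mem_ne_zero_of_ne_bot hI
  obtain ⟨q, hq⟩ := X_pow_order_dvd (φ := p)
  have hc : constantCoeff q ≠ 0 := by
    -- The constant coefficient of `q` is the leading coefficient of `p`.
    have h' := coeff_X_pow_mul q p.order.toNat 0
    rw [zero_add, coeff_zero_eq_constantCoeff_apply] at h'
    rw [← h', ← hq]
    exact coeff_order hp0
  have h1 := mul_invOfUnit q (Units.mk0 _ hc) rfl
  refine ⟨p.order.toNat, ?_⟩
  have h2 := I.mul_mem_right (invOfUnit q (Units.mk0 _ hc)) hp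
  rwa [hq, mul_assoc, h1, mul_one] at h2

/-- Otherwise the power series ring itself would be finite-dimensional, whereas the powers of `X`
are linearly independent. -/
theorem ne_bot_of_finiteDimensional_quotient {A : Type v} [Ring A] [Nontrivial A] [Algebra k A]
    {I : Ideal (PowerSeries A)} (hI : FiniteDimensional k (PowerSeries A ⧸ I.restrictScalars k)) :
    I ≠ ⊥ := by
  rintro rfl
  have h : ((⊥ : Ideal (PowerSeries A)).restrictScalars k) = ⊥ := rfl
  rw [h] at hI
  have hf : FiniteDimensional k (PowerSeries A) :=
    (Submodule.quotEquivOfEqBot _ rfl).finiteDimensional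
  have hli : LinearIndependent k fun n : ℕ => monomialLinear k A n 1 := by
    rw [linearIndependent_iff']
    intro s g hg i hi
    have := congrArg (coeffLinear k A i) hg
    simpa [map_sum, coeff_monomial, hi] using this
  exact not_finite_iff_infinite.2 (inferInstance : Infinite ℕ) hli.finite

/-- The functional kills an ideal containing some `X ^ n`, hence all multiples of `X ^ n`, and so
depends only on the coefficients below degree `n`. -/
theorem exists_functional_eq_zero_of_X_pow_dvd {D : Type v} [DivisionRing D] [Algebra k D]
    (f : FiniteDual k (PowerSeries D)) :
    ∃ n, ∀ p ∈ idealXPow D n, FiniteDual.incl k _ f p = 0 := by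
  obtain ⟨f, I, hI, hI', hf⟩ := f
  obtain ⟨n, hn⟩ := exists_X_pow_mem (ne_bot_of_finiteDimensional_quotient hI')
  refine ⟨n, ?_⟩
  rintro _ ⟨q, rfl⟩
  exact hf _ (I.mul_mem_right q hn)

/-- The functional `p ↦ f (pₙ)` on power series, in the finite dual. -/
noncomputable def coeffFunctional (k : Type u) [Field k] (A : Type v) [Ring A] [Algebra k A]
    [FiniteDimensional k A] (n : ℕ) : Dual k A →ₗ[k] FiniteDual k (PowerSeries A) :=
  LinearMap.codRestrict (finiteDual k (PowerSeries A)) (coeffLinear k A n).dualMap fun f =>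
    -- The exponent is `n + 1` because the coefficient of degree `n` itself has to vanish on the
    -- ideal.
    ⟨idealXPow A (n + 1), inferInstance, finiteDimensional_quotient_idealXPow k A (n + 1),
      fun p hp => by
        rw [LinearMap.dualMap_apply, coeffLinear_apply, mem_idealXPow.1 hp n n.lt_succ_self,
          map_zero]⟩

@[simp]
theorem incl_coeffFunctional {A : Type v} [Ring A] [Algebra k A] [FiniteDimensional k A] (n : ℕ)
    (f : Dual k A) (p : PowerSeries A) :
    FiniteDual.incl k _ (coeffFunctional k A n f) p = f (coeff n p) := rfl

end PowerSeries

/-! ### The comparison map and its bijectivity. -/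

namespace CotensorCoalgebra

open Module Bicomodule FunctionalPairing PowerSeries

variable {k : Type u} [Field k] {D : Type v} [DivisionRing D] [Algebra k D] [FiniteDimensional k D]
  {M : Bicomodule k (Dual k D)} {e : M.carrier →ₗ[k] Dual k D}

/-- The component of degree `n` of an element of the cotensor coalgebra. -/
noncomputable def component (M : Bicomodule k (Dual k D)) (n : ℕ) :
    CotensorCoalgebra M →ₗ[k] (M.pow n).carrier :=
  DirectSum.component k ℕ (fun n => (M.pow n).carrier) n

theorem component_incl_self (M : Bicomodule k (Dual k D)) (n : ℕ) (x : (M.pow n).carrier) :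
    component M n (incl M n x) = x :=
  DirectSum.component.lof_self k (M := fun n => (M.pow n).carrier) n x

theorem component_incl_of_ne (M : Bicomodule k (Dual k D)) {m n : ℕ} (h : m ≠ n)
    (x : (M.pow m).carrier) : component M n (incl M m x) = 0 :=
  (DirectSum.component.of k (M := fun n => (M.pow n).carrier) n m x).trans (dif_neg h)

theorem ext_component {M : Bicomodule k (Dual k D)} {s t : CotensorCoalgebra M}
    (h : ∀ n, component M n s = component M n t) : s = t :=
  DirectSum.ext_component k h

/-- The map `T_{D^*}(M) → D[[x]]°` sending `x ∈ M^{□ n}` to the functional given by `x` on the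
coefficient of degree `n`. -/
noncomputable def toFiniteDual (e : M.carrier →ₗ[k] Dual k D) :
    CotensorCoalgebra M →ₗ[k] FiniteDual k (PowerSeries D) :=
  fromSum M fun n => coeffFunctional k D n ∘ₗ powEval e n

theorem toFiniteDual_incl (e : M.carrier →ₗ[k] Dual k D) (n : ℕ) (x : (M.pow n).carrier) :
    toFiniteDual e (incl M n x) = coeffFunctional k D n (powEval e n x) :=
  fromSum_incl M _ n x

/-- Monomials of degree `n` isolate the component of degree `n`, which gives injectivity. -/
theorem toFiniteDual_monomial (e : M.carrier →ₗ[k] Dual k D) (t : CotensorCoalgebra M) (n : ℕ)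
    (d : D) : FiniteDual.incl k _ (toFiniteDual e t) (monomial n d) =
      powEval e n (component M n t) d := by
  have h : LinearMap.applyₗ (monomial n d) ∘ₗ FiniteDual.incl k (PowerSeries D) ∘ₗ toFiniteDual e =
      LinearMap.applyₗ d ∘ₗ powEval e n ∘ₗ component M n := by
    apply hom_ext
    intro m x
    simp only [LinearMap.comp_apply, toFiniteDual_incl, LinearMap.applyₗ_apply_apply,
      incl_coeffFunctional, coeff_monomial]
    by_cases hmn : m = n
    · subst hmn
      rw [if_pos rfl, component_incl_self]
    · rw [if_neg hmn, component_incl_of_ne M hmn, map_zero, map_zero, LinearMap.zero_apply]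
  exact LinearMap.congr_fun h t

theorem toFiniteDual_injective (he : ∀ n, Function.Injective (powEval e n)) :
    Function.Injective (toFiniteDual e) := by
  intro s t hst
  refine ext_component fun n => he n (LinearMap.ext fun d => ?_)
  rw [← toFiniteDual_monomial, ← toFiniteDual_monomial, hst]

theorem toFiniteDual_surjective (he : ∀ n, Function.Surjective (powEval e n)) :
    Function.Surjective (toFiniteDual e) := by
  intro f
  obtain ⟨N, hN⟩ := exists_functional_eq_zero_of_X_pow_dvd f
  -- The component in degree `n` is forced: it must represent `d ↦ f(d xⁿ)`. Degrees below `N`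
  -- suffice.
  choose x hx using fun n => he n (FiniteDual.incl k _ f ∘ₗ monomialLinear k D n)
  refine ⟨∑ n ∈ Finset.range N, incl M n (x n), ?_⟩
  apply FiniteDual.incl_injective
  ext p
  simp only [map_sum, LinearMap.sum_apply, toFiniteDual_incl, incl_coeffFunctional, hx,
    LinearMap.comp_apply, monomialLinear_apply]
  -- The sum is `f` at the truncation of `p` below degree `N`, and `p` minus its truncation is
  -- divisible by `X ^ N`.
  rw [← map_sum, eq_comm, ← sub_eq_zero, ← map_sub]
  apply hN
  rw [mem_idealXPow]
  intro m hm
  simp [coeff_monomial, hm]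

theorem counit_toFiniteDual (e : M.carrier →ₗ[k] Dual k D) :
    Coalgebra.counit (R := k) ∘ₗ toFiniteDual e = Coalgebra.counit (R := k) := by
  apply hom_ext
  intro n x
  rw [LinearMap.comp_apply, toFiniteDual_incl, finiteDualCoalgebra_counit, incl_coeffFunctional,
    coeff_one]
  obtain _ | n := n
  · exact (counit_incl_zero M x).symm
  · rw [counit_incl_succ, if_neg n.succ_ne_zero, map_zero]

/-- Evaluated at `p ⊗ q`, both sides are sums over `i + j = n`: one comes from the components of the
comultiplication, the other from the Cauchy product. They agree term by term by `isMulDual_splitAt`.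
-/
theorem map_comp_comul_toFiniteDual (hr : IsMulDual e e LinearMap.id M.rco)
    (hl : IsMulDual e LinearMap.id e M.lco) :
    TensorProduct.map (toFiniteDual e) (toFiniteDual e) ∘ₗ Coalgebra.comul (R := k) =
      Coalgebra.comul (R := k) ∘ₗ toFiniteDual e := by
  apply hom_ext
  intro n x
  apply evalTwo_injective _ (FiniteDual.incl_injective k (PowerSeries D))
  refine TensorProduct.ext' fun p q => ?_
  -- A tensor of bidegree `(i, j)` sees only the coefficient of degree `i` in `p` and that of degree
  -- `j` in `q`.
  have key : ∀ i j (z : (M.pow i).carrier ⊗[k] (M.pow j).carrier),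
      evalTwo (FiniteDual.incl k (PowerSeries D)) (TensorProduct.map (toFiniteDual e)
        (toFiniteDual e) (TensorProduct.map (incl M i) (incl M j) z)) (p ⊗ₜ[k] q) =
      pairing (powEval e i) (powEval e j) z (coeff i p ⊗ₜ[k] coeff j q) := by
    intro i j z
    induction z with
    | zero => simp
    | add x y hx hy => simp only [map_add, LinearMap.add_apply, hx, hy]
    | tmul x y => simp [toFiniteDual_incl]
  rw [LinearMap.comp_apply, LinearMap.comp_apply, finiteDualCoalgebra_isDualTo, comul_incl,
    toFiniteDual_incl, incl_coeffFunctional, coeff_mul]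
  simp only [map_sum, LinearMap.sum_apply, key]
  refine Finset.sum_congr rfl fun i hi => ?_
  exact isMulDual_splitAt hr hl (Finset.HasAntidiagonal.mem_antidiagonal.1 hi) x _ _

/-- The coalgebra isomorphism `T_{D^*}(M) ≃ D[[x]]°` for a bicomodule `M` identified with the
regular bicomodule `D^*`. -/
noncomputable def equivFiniteDual (he : Function.Bijective e)
    (hr : IsMulDual e e LinearMap.id M.rco) (hl : IsMulDual e LinearMap.id e M.lco) :
    CotensorCoalgebra M ≃ₗc[k] FiniteDual k (PowerSeries D) :=
  CoalgEquiv.ofBijective (f :=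
    ({ toLinearMap := toFiniteDual e
       counit_comp := counit_toFiniteDual e
       map_comp_comul := map_comp_comul_toFiniteDual hr hl } :
      CotensorCoalgebra M →ₗc[k] FiniteDual k (PowerSeries D)))
    ⟨toFiniteDual_injective fun n => (powEval_bijective he hr hl n).1,
      toFiniteDual_surjective fun n => (powEval_bijective he hr hl n).2⟩

end CotensorCoalgebra

/-- The carrier of the untwisted bicomodule is `D^*` itself, so the identification `e` is the
identity map. -/
theorem mainTheorem6 {k : Type*} [Field k] {D : Type*} [DivisionRing D] [Algebra k D]
    [FiniteDimensional k D] :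
    Nonempty (DC k (AlgEquiv.refl : D ≃ₐ[k] D) ≃ₗc[k] FiniteDual k (PowerSeries D)) :=
  ⟨CotensorCoalgebra.equivFiniteDual Function.bijective_id Bicomodule.isMulDual_twistedDual_rco
    (Bicomodule.isMulDual_twistedDual_lco AlgEquiv.refl)⟩
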